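/- For $v\in\mathbb R^k$ and $W\in\mathbb R^{k\times d}$ let $f_{v,W}(x)=\sum_{\ell=1}^k v_\ell\,(Wx)_\ell^2$, the network with one hidden layer and quadratic activation. Let $W^*\in\mathbb R^{k\times d}$ with $k\ge d$ and smallest singular value $\sigma_{\min}(W^*)>0$, and let $v^*\in\mathbb R^k$ have nonzero entries that are all of the same sign. Given inputs $x_1,\dots,x_n\in\mathbb R^d$, let the labels be $y_i=f_{v^*,W^*}(x_i)$, and for fixed $v\in\mathbb R^k$ consider the training loss $$\mathcal L(W)=\frac1{2n}\sum_{i=1}^n\bigl(y_i-f_{v,W}(x_i)\bigr)^2,\qquad W\in\mathbb R^{k\times d}.$$ (1) There is a universal constant $c>0$ such that the following holds. Suppose that at least $d$ entries of $v$ are nonzero, that all nonzero entries of $v$ have one and the same sign, which is the sign of the nonzero entries of $v^*$, and that $d\le n\le cd^2$. Then for (Lebesgue-)almost every $(x_1,\dots,x_n)$: every local minimum of $\mathcal L$ is a global minimum; at every critical point $W_s$ that is not a local minimum (in particular at every saddle point) there is a direction $U\in\mathbb R^{k\times d}$ with $\mathrm{vect}(U)^T\nabla^2\mathcal L(W_s)\,\mathrm{vect}(U)<0$;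 global minima of $\mathcal L$ exist, and $\mathcal L=0$ at each of them. (2) There are universal constants $c,C,\gamma>0$ such that the following holds. Suppose that $k>d$, that $c\,d\log d\le n\le Cd^2$, that $x_1,\dots,x_n$ are i.i.d. $\mathcal N(0,I_d)$, and that $v=\nu\mathbf 1$, where $\nu\ne0$ has the same sign as the nonzero entries of $v^*$. Then, with probability at least $1-12de^{-\gamma d}-8/d$, for all $\epsilon_g,\epsilon_H\ge0$ every $W\in\mathbb R^{k\times d}$ with $\|\nabla\mathcal L(W)\|_F\le\epsilon_g$ and $\nabla^2\mathcal L(W)\succeq-\epsilon_H I$ satisfies $$\mathcal L(W)\le\frac{\epsilon_g}{\sqrt{|\nu|}}\max\Bigl(\sqrt{1+14\,\|{W^*}^TD_{v^*}W^*\|_*},\ \frac{4\epsilon_g}{\sqrt{|\nu|}}\Bigr)+\frac{\epsilon_H}{2|\nu|}\,\|{W^*}^TD_{v^*}W^*\|_*,$$ where $D_{v^*}=\mathrm{diag}(v^*)$ and $\|\cdot\|_*$ is the nuclear norm (the sum of the singular values). -/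

import Mathlib

open scoped Matrix
open MeasureTheory ProbabilityTheory

noncomputable section

/-- The output `vᵀ φ(W x)` of the one-hidden-layer network with quadratic activation `φ(z) = z²`. -/
def quadNet {k d : ℕ} (v : Fin k → ℝ) (W : Matrix (Fin k) (Fin d) ℝ)
    (x : EuclideanSpace ℝ (Fin d)) : ℝ :=
  ∑ l, v l * (W *ᵥ x.ofLp) l ^ 2

/-- The matrix in `ℝ^{k×d}` with vectorization `w`. The space `EuclideanSpace ℝ (Fin k × Fin d)` of
vectorized matrices carries the Frobenius inner product. -/
def unvec {k d : ℕ} (w : EuclideanSpace ℝ (Fin k × Fin d)) : Matrix (Fin k) (Fin d) ℝ :=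
  Matrix.of fun l j => w (l, j)

/-- The training loss `(1 / 2n) ∑ᵢ (yᵢ - vᵀ φ(W xᵢ))²` as a function of `vect(W)`. -/
def trainLoss {n k d : ℕ} (v : Fin k → ℝ) (x : Fin n → EuclideanSpace ℝ (Fin d)) (y : Fin n → ℝ)
    (w : EuclideanSpace ℝ (Fin k × Fin d)) : ℝ :=
  1 / (2 * (n : ℝ)) * ∑ i, (y i - quadNet v (unvec w) (x i)) ^ 2

/-- The labels `yᵢ = ⟨v*, φ(W* xᵢ)⟩` planted by `v*` and `W*`. -/
def plantedLabels {n k d : ℕ} (vs : Fin k → ℝ) (Ws : Matrix (Fin k) (Fin d) ℝ)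
    (x : Fin n → EuclideanSpace ℝ (Fin d)) : Fin n → ℝ :=
  fun i => quadNet vs Ws (x i)

/-- The loss for planted labels, as a function of `vect(W)`. -/
def plantedLoss {n k d : ℕ} (v vs : Fin k → ℝ) (Ws : Matrix (Fin k) (Fin d) ℝ)
    (x : Fin n → EuclideanSpace ℝ (Fin d)) : EuclideanSpace ℝ (Fin k × Fin d) → ℝ :=
  trainLoss v x (plantedLabels vs Ws x)

/-- The quadratic form `vect(U)ᵀ ∇²f(W) vect(U)`. -/
def hessForm {k d : ℕ} (f : EuclideanSpace ℝ (Fin k × Fin d) → ℝ)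
    (w u : EuclideanSpace ℝ (Fin k × Fin d)) : ℝ :=
  iteratedFDeriv ℝ 2 f w ![u, u]

/-- The smallest of the `min k d` singular values of a `k × d` matrix
(singular values are listed in decreasing order, starting from index `0`). -/
def sigmaMin {k d : ℕ} (A : Matrix (Fin k) (Fin d) ℝ) : ℝ :=
  (Matrix.toEuclideanLin A).singularValues (min k d - 1)

/-- The nuclear norm: the sum of the singular values. -/
def nuclearNorm {d : ℕ} (A : Matrix (Fin d) (Fin d) ℝ) : ℝ :=
  ∑ i ∈ Finset.range d, (Matrix.toEuclideanLin A).singularValues i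

/-- `(ε_g, ε_H)`-approximate local minimum: `‖∇f(W)‖_F ≤ ε_g` and `∇²f(W) ⪰ -ε_H I`. -/
def IsApproxLocalMin {k d : ℕ} (f : EuclideanSpace ℝ (Fin k × Fin d) → ℝ) (εg εH : ℝ)
    (w : EuclideanSpace ℝ (Fin k × Fin d)) : Prop :=
  ‖gradient f w‖ ≤ εg ∧ ∀ u, -εH * ‖u‖ ^ 2 ≤ hessForm f w u

/-- The nonzero entries of both `a` and `b` are all positive, or they are all negative. -/
def SameSign {k : ℕ} (a b : Fin k → ℝ) : Prop :=
  ((∀ l, 0 ≤ a l) ∧ ∀ l, 0 ≤ b l) ∨ ((∀ l, a l ≤ 0) ∧ ∀ l, b l ≤ 0)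

/-- The law of `n` i.i.d. `N(0, I_d)` vectors. -/
def gaussianData (n d : ℕ) : Measure (Fin n → EuclideanSpace ℝ (Fin d)) :=
  Measure.pi fun _ => stdGaussian (EuclideanSpace ℝ (Fin d))

end

/-! Write `q i` for the network outputs, `r i = q i - y i` for the residuals and `M = ∑ rᵢ xᵢ xᵢᵀ`.
Everything rests on the identity `2n·L = ∑ rᵢ qᵢ - ∑ rᵢ yᵢ` (`trainLoss_eq`). The first sum is the
radial derivative of the loss up to a factor, hence small at nearly critical points. The second is
the pairing of `M` with `W*ᵀ D_{v*} W*`, hence bounded below once `M` is. After a global sign change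
all output weights are nonnegative.

If `∑ v_l a_l w_l = 0` for the rows `w_l` of `W`, the Hessian in a direction `a bᵀ` is a positive
multiple of `bᵀ M b`, provided some `v_l a_l` is nonzero (`hessForm_vecOuter`). So a second-order
condition at weights with dependent active rows bounds `M` from below.

(1) At a second-order stationary point, either the active rows are dependent, so `M ⪰ 0` and `2n·L =
-∑ rᵢ yᵢ ≤ 0`; or they span, the gradient equation forces `M = 0`, and `r = 0` because the `xᵢ xᵢᵀ`
are linearly independent (`plantedLoss_eq_zero_of_stationary`). This independence is generic for `n
≤ d(d-1)/2` (`ae_det_sqGram_ne_zero`). A zero of the loss exists by factoring `W*ᵀ D_{v*} W*` as `Bᵀ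
B` (`exists_quadNet_eq`), and the three claims on the landscape follow.

(2) For `k > d` the rows are always dependent, so `M ⪰ -(n ε_H / 2ν) I`, and the trace of `W*ᵀ
D_{v*} W*`, at most its nuclear norm, controls the second sum. The first is at most `n ε_g ‖W‖ / 2`,
which leaves a bound on `‖W‖`. It needs `∑ xᵢ xᵢᵀ ⪰ (n/16) I` and `∑ yᵢ² ≤ n (14a)²`, with `a` the
trace (`plantedLoss_le_of_isApproxLocalMin`). Both hold with probability at least `1 - 3/d` for `d ≥
9`: a Chernoff bound on a fine grid handles the first, Chebyshev's inequality the second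
(`exists_gaussianData_event`). -/

/-! ### Derivatives of the training loss -/

/-- The symmetric bilinear form in the weights whose quadratic form is `w ↦ quadNet v (unvec w) x`. -/
def netBilin {k d : ℕ} (v : Fin k → ℝ) (x : EuclideanSpace ℝ (Fin d))
    (w u : EuclideanSpace ℝ (Fin k × Fin d)) : ℝ :=
  ∑ l, v l * ((unvec w *ᵥ x.ofLp) l * (unvec u *ᵥ x.ofLp) l)

section Calculus

variable {n k d : ℕ} (v : Fin k → ℝ)

theorem netBilin_self (x : EuclideanSpace ℝ (Fin d)) (w : EuclideanSpace ℝ (Fin k × Fin d)) :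
    netBilin v x w w = quadNet v (unvec w) x := by
  simp [netBilin, quadNet, sq]

theorem unvec_add_smul (w u : EuclideanSpace ℝ (Fin k × Fin d)) (t : ℝ) :
    unvec (w + t • u) = unvec w + t • unvec u := by
  ext; simp [unvec]

theorem quadNet_add_smul (x : EuclideanSpace ℝ (Fin d)) (w u : EuclideanSpace ℝ (Fin k × Fin d))
    (t : ℝ) :
    quadNet v (unvec (w + t • u)) x =
      quadNet v (unvec w) x + 2 * t * netBilin v x w u + t ^ 2 * quadNet v (unvec u) x := by
  simp only [quadNet, netBilin, unvec_add_smul, Matrix.add_mulVec, Matrix.smul_mulVec,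
    Pi.add_apply, Pi.smul_apply, smul_eq_mul, Finset.mul_sum, ← Finset.sum_add_distrib]
  exact Finset.sum_congr rfl fun l _ => by ring

theorem netBilin_add_smul (x : EuclideanSpace ℝ (Fin d)) (w u : EuclideanSpace ℝ (Fin k × Fin d))
    (t : ℝ) :
    netBilin v x (w + t • u) u = netBilin v x w u + t * quadNet v (unvec u) x := by
  simp only [quadNet, netBilin, unvec_add_smul, Matrix.add_mulVec, Matrix.smul_mulVec,
    Pi.add_apply, Pi.smul_apply, smul_eq_mul, Finset.mul_sum, ← Finset.sum_add_distrib]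
  exact Finset.sum_congr rfl fun l _ => by ring

variable (x : Fin n → EuclideanSpace ℝ (Fin d)) (y : Fin n → ℝ)

theorem contDiff_trainLoss : ContDiff ℝ 2 (trainLoss (k := k) v x y) := by
  unfold trainLoss quadNet unvec Matrix.mulVec dotProduct
  simp only [Matrix.of_apply]
  fun_prop

/-- Each residual is a quadratic polynomial in `t` along `w + t • u`, so a one-variable derivative
suffices. The Hessian is found in the same way from this formula. -/
theorem fderiv_trainLoss (w u : EuclideanSpace ℝ (Fin k × Fin d)) :
    fderiv ℝ (trainLoss v x y) w u =
      2 / (n : ℝ) * ∑ i, (quadNet v (unvec w) (x i) - y i) * netBilin v (x i) w u := by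
  have h1 : HasDerivAt (fun t : ℝ => trainLoss v x y (w + t • u))
      (fderiv ℝ (trainLoss v x y) w u) 0 :=
    ((contDiff_trainLoss v x y).differentiable (by norm_num) w).hasFDerivAt.hasLineDerivAt u
  refine h1.unique ?_
  simp only [trainLoss, quadNet_add_smul]
  have h2 : ∀ i, HasDerivAt (fun t : ℝ => (y i - (quadNet v (unvec w) (x i) +
      2 * t * netBilin v (x i) w u + t ^ 2 * quadNet v (unvec u) (x i))) ^ 2)
      (4 * ((quadNet v (unvec w) (x i) - y i) * netBilin v (x i) w u)) 0 := by
    intro i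
    have h := ((((((hasDerivAt_id (0 : ℝ)).const_mul 2).mul_const (netBilin v (x i) w u)).const_add
      (quadNet v (unvec w) (x i))).add
      (((hasDerivAt_id (0 : ℝ)).pow 2).mul_const (quadNet v (unvec u) (x i)))).const_sub (y i)).pow 2
    refine h.congr_deriv ?_
    simp
    ring
  refine ((HasDerivAt.fun_sum fun i _ => h2 i).const_mul (1 / (2 * (n : ℝ)))).congr_deriv ?_
  rw [← Finset.mul_sum]
  ring

theorem inner_gradient_trainLoss (w u : EuclideanSpace ℝ (Fin k × Fin d)) :
    inner ℝ (gradient (trainLoss v x y) w) u =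
      2 / (n : ℝ) * ∑ i, (quadNet v (unvec w) (x i) - y i) * netBilin v (x i) w u := by
  rw [← fderiv_trainLoss, gradient, InnerProductSpace.toDual_symm_apply]

theorem hessForm_trainLoss (w u : EuclideanSpace ℝ (Fin k × Fin d)) :
    hessForm (trainLoss v x y) w u =
      2 / (n : ℝ) * ∑ i, (2 * netBilin v (x i) w u ^ 2 +
        (quadNet v (unvec w) (x i) - y i) * quadNet v (unvec u) (x i)) := by
  rw [hessForm, iteratedFDeriv_two_apply]
  simp only [Matrix.cons_val_zero, Matrix.cons_val_one]
  have hd : Differentiable ℝ (fderiv ℝ (trainLoss (k := k) v x y)) :=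
    ((contDiff_trainLoss v x y).fderiv_right (m := 1) (by norm_num)).differentiable (by norm_num)
  have h0 : HasDerivAt (fun t : ℝ => fderiv ℝ (trainLoss v x y) (w + t • u))
      (fderiv ℝ (fderiv ℝ (trainLoss v x y)) w u) 0 := (hd w).hasFDerivAt.hasLineDerivAt u
  have h1 := h0.clm_apply (hasDerivAt_const (0 : ℝ) u)
  simp only [map_zero, add_zero] at h1
  refine h1.unique ?_
  simp only [fderiv_trainLoss, quadNet_add_smul, netBilin_add_smul]
  have h2 : ∀ i, HasDerivAt (fun t : ℝ => (quadNet v (unvec w) (x i) +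
      2 * t * netBilin v (x i) w u + t ^ 2 * quadNet v (unvec u) (x i) - y i) *
        (netBilin v (x i) w u + t * quadNet v (unvec u) (x i)))
      (2 * netBilin v (x i) w u ^ 2 +
        (quadNet v (unvec w) (x i) - y i) * quadNet v (unvec u) (x i)) 0 := by
    intro i
    have h := ((((((hasDerivAt_id (0 : ℝ)).const_mul 2).mul_const (netBilin v (x i) w u)).const_add
      (quadNet v (unvec w) (x i))).add
      (((hasDerivAt_id (0 : ℝ)).pow 2).mul_const (quadNet v (unvec u) (x i)))).sub_const (y i)).mul
      (((hasDerivAt_id (0 : ℝ)).mul_const (quadNet v (unvec u) (x i))).const_add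
        (netBilin v (x i) w u))
    refine h.congr_deriv ?_
    simp
    ring
  exact (HasDerivAt.fun_sum fun i _ => h2 i).const_mul (2 / (n : ℝ))

theorem trainLoss_add_smul (w u : EuclideanSpace ℝ (Fin k × Fin d)) :
    ∃ a b : ℝ, ∀ t : ℝ, trainLoss v x y (w + t • u) = trainLoss v x y w +
      t * inner ℝ (gradient (trainLoss v x y) w) u +
      t ^ 2 * (hessForm (trainLoss v x y) w u / 2) + t ^ 3 * a + t ^ 4 * b := by
  refine ⟨1 / (2 * (n : ℝ)) * ∑ i, 4 * (netBilin v (x i) w u * quadNet v (unvec u) (x i)),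
    1 / (2 * (n : ℝ)) * ∑ i, quadNet v (unvec u) (x i) ^ 2, fun t => ?_⟩
  have e : (2 : ℝ) / n = 1 / (2 * n) * 4 := by ring
  rw [inner_gradient_trainLoss, hessForm_trainLoss, e]
  simp only [trainLoss, quadNet_add_smul, Finset.mul_sum, Finset.sum_div,
    ← Finset.sum_add_distrib]
  exact Finset.sum_congr rfl fun i _ => by ring

/-- The second-order necessary condition. -/
theorem hessForm_nonneg_of_isLocalMin {w : EuclideanSpace ℝ (Fin k × Fin d)}
    (hw : IsLocalMin (trainLoss v x y) w) :
    gradient (trainLoss v x y) w = 0 ∧ ∀ u, 0 ≤ hessForm (trainLoss v x y) w u := by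
  have hg : gradient (trainLoss v x y) w = 0 := by
    rw [gradient, hw.fderiv_eq_zero, map_zero]
  refine ⟨hg, fun u => ?_⟩
  obtain ⟨a, b, hab⟩ := trainLoss_add_smul v x y w u
  simp only [hg, inner_zero_left, mul_zero, add_zero] at hab
  have hc : Filter.Tendsto (fun t : ℝ => w + t • u) (nhds 0) (nhds w) := by
    have : Continuous fun t : ℝ => w + t • u := by fun_prop
    simpa using this.tendsto 0
  have hev := (hc.eventually hw).filter_mono (nhdsWithin_le_nhds (s := Set.Ioi 0))
  -- This is the increment of the loss divided by `t ^ 2`; it is nonnegative for small `t > 0`.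
  have hlim : Filter.Tendsto (fun t : ℝ => hessForm (trainLoss v x y) w u / 2 + t * a + t ^ 2 * b)
      (nhdsWithin 0 (Set.Ioi 0)) (nhds (hessForm (trainLoss v x y) w u / 2)) := by
    have : Continuous fun t : ℝ => hessForm (trainLoss v x y) w u / 2 + t * a + t ^ 2 * b := by
      fun_prop
    simpa using (this.tendsto 0).mono_left (nhdsWithin_le_nhds (s := Set.Ioi 0))
  have hge : 0 ≤ hessForm (trainLoss v x y) w u / 2 := by
    refine ge_of_tendsto hlim ?_
    filter_upwards [hev, self_mem_nhdsWithin] with t ht htpos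
    rw [hab] at ht
    have htpos : (0 : ℝ) < t := htpos
    have h2 : 0 < t ^ 2 := by positivity
    have : 0 ≤ t ^ 2 * (hessForm (trainLoss v x y) w u / 2 + t * a + t ^ 2 * b) := by linarith
    exact nonneg_of_mul_nonneg_right this h2
  linarith

end Calculus

/-! ### Consequences of the second-order conditions -/

/-- The vectorization of the rank-one matrix `a bᵀ`. -/
def vecOuter {k d : ℕ} (a : Fin k → ℝ) (b : EuclideanSpace ℝ (Fin d)) :
    EuclideanSpace ℝ (Fin k × Fin d) :=
  WithLp.toLp 2 fun p => a p.1 * b p.2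

section Landscape

variable {n k d : ℕ}

theorem mulVec_eq_inner (W : Matrix (Fin k) (Fin d) ℝ) (x : EuclideanSpace ℝ (Fin d)) (l : Fin k) :
    (W *ᵥ x.ofLp) l = inner ℝ (WithLp.toLp 2 (W l)) x := by
  simp [Matrix.mulVec, dotProduct, PiLp.inner_apply, mul_comm]

theorem quadNet_eq_inner (v : Fin k → ℝ) (W : Matrix (Fin k) (Fin d) ℝ)
    (x : EuclideanSpace ℝ (Fin d)) :
    quadNet v W x = ∑ l, v l * inner ℝ (WithLp.toLp 2 (W l)) x ^ 2 := by
  simp [quadNet, mulVec_eq_inner]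

theorem unvec_vecOuter_mulVec (a : Fin k → ℝ) (b x : EuclideanSpace ℝ (Fin d)) (l : Fin k) :
    (unvec (vecOuter a b) *ᵥ x.ofLp) l = a l * inner ℝ b x := by
  simp [Matrix.mulVec, dotProduct, PiLp.inner_apply, unvec, vecOuter, Finset.mul_sum]
  exact Finset.sum_congr rfl fun _ _ => by ring

theorem norm_vecOuter_sq (a : Fin k → ℝ) (b : EuclideanSpace ℝ (Fin d)) :
    ‖vecOuter a b‖ ^ 2 = (∑ l, a l ^ 2) * ‖b‖ ^ 2 := by
  simp [EuclideanSpace.real_norm_sq_eq, vecOuter, Fintype.sum_prod_type, Finset.sum_mul_sum,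
    mul_pow]

theorem norm_sq_eq_sum_rows (w : EuclideanSpace ℝ (Fin k × Fin d)) :
    ‖w‖ ^ 2 = ∑ l, ‖WithLp.toLp 2 (unvec w l)‖ ^ 2 := by
  simp [EuclideanSpace.real_norm_sq_eq, unvec, Fintype.sum_prod_type]

theorem quadNet_vecOuter (v a : Fin k → ℝ) (b x : EuclideanSpace ℝ (Fin d)) :
    quadNet v (unvec (vecOuter a b)) x = (∑ l, v l * a l ^ 2) * inner ℝ b x ^ 2 := by
  simp only [quadNet, unvec_vecOuter_mulVec, Finset.sum_mul]
  exact Finset.sum_congr rfl fun _ _ => by ring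

theorem netBilin_vecOuter (v a : Fin k → ℝ) (b x : EuclideanSpace ℝ (Fin d))
    (w : EuclideanSpace ℝ (Fin k × Fin d)) :
    netBilin v x w (vecOuter a b) =
      inner ℝ (∑ l, (v l * a l) • WithLp.toLp 2 (unvec w l)) x * inner ℝ b x := by
  simp only [netBilin, unvec_vecOuter_mulVec]
  simp only [mulVec_eq_inner, sum_inner, real_inner_smul_left, Finset.sum_mul]
  exact Finset.sum_congr rfl fun _ _ => by ring

/-- The relation `ha` makes the outputs stationary to first order in the direction `a bᵀ`, so the
square terms of the Hessian vanish and only the residual term is left. -/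
theorem hessForm_vecOuter (v : Fin k → ℝ) (x : Fin n → EuclideanSpace ℝ (Fin d)) (y : Fin n → ℝ)
    {a : Fin k → ℝ} {w : EuclideanSpace ℝ (Fin k × Fin d)}
    (ha : ∑ l, (v l * a l) • WithLp.toLp 2 (unvec w l) = 0) (b : EuclideanSpace ℝ (Fin d)) :
    hessForm (trainLoss v x y) w (vecOuter a b) = 2 / (n : ℝ) * ((∑ l, v l * a l ^ 2) *
      ∑ i, (quadNet v (unvec w) (x i) - y i) * inner ℝ b (x i) ^ 2) := by
  rw [hessForm_trainLoss, Finset.mul_sum (a := ∑ l, v l * a l ^ 2)]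
  congr 1
  refine Finset.sum_congr rfl fun i _ => ?_
  rw [netBilin_vecOuter, ha, quadNet_vecOuter, inner_zero_left]
  ring

theorem trainLoss_nonneg (v : Fin k → ℝ) (x : Fin n → EuclideanSpace ℝ (Fin d)) (y : Fin n → ℝ)
    (w : EuclideanSpace ℝ (Fin k × Fin d)) : 0 ≤ trainLoss v x y w := by
  unfold trainLoss; positivity

theorem trainLoss_eq (v : Fin k → ℝ) (x : Fin n → EuclideanSpace ℝ (Fin d)) (y : Fin n → ℝ)
    (w : EuclideanSpace ℝ (Fin k × Fin d)) :
    trainLoss v x y w = 1 / (2 * (n : ℝ)) *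
      (∑ i, (quadNet v (unvec w) (x i) - y i) * quadNet v (unvec w) (x i) -
        ∑ i, (quadNet v (unvec w) (x i) - y i) * y i) := by
  rw [trainLoss, ← Finset.sum_sub_distrib]
  congr 1
  exact Finset.sum_congr rfl fun _ _ => by ring

/-- The loss does not change when all output weights, planted ones included, change sign. -/
theorem plantedLoss_neg (v vs : Fin k → ℝ) (Ws : Matrix (Fin k) (Fin d) ℝ)
    (x : Fin n → EuclideanSpace ℝ (Fin d)) :
    plantedLoss (-v) (-vs) Ws x = plantedLoss v vs Ws x := by
  ext w
  simp only [plantedLoss, trainLoss, plantedLabels, quadNet, Pi.neg_apply, neg_mul,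
    Finset.sum_neg_distrib]
  congr 1
  exact Finset.sum_congr rfl fun _ _ => by ring

/-- A lower bound on the quadratic form of `∑ rᵢ xᵢ xᵢᵀ` passes through this formula to the
correlation of residuals and labels when `vs` is nonnegative. -/
theorem sum_mul_plantedLabels (vs : Fin k → ℝ) (Ws : Matrix (Fin k) (Fin d) ℝ)
    (x : Fin n → EuclideanSpace ℝ (Fin d)) (r : Fin n → ℝ) :
    ∑ i, r i * plantedLabels vs Ws x i =
      ∑ l, vs l * ∑ i, r i * inner ℝ (WithLp.toLp 2 (Ws l)) (x i) ^ 2 := by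
  simp only [plantedLabels, quadNet_eq_inner, Finset.mul_sum]
  rw [Finset.sum_comm]
  exact Finset.sum_congr rfl fun _ _ => Finset.sum_congr rfl fun _ _ => by ring

/-- Second-order stationary points have loss zero as soon as the `xᵢ xᵢᵀ` are linearly
independent. -/
theorem plantedLoss_eq_zero_of_stationary (hn : n ≠ 0) {v vs : Fin k → ℝ} (hv : ∀ l, 0 ≤ v l)
    (hvs : ∀ l, 0 ≤ vs l) (hcard : d ≤ Nat.card {l // v l ≠ 0}) (Ws : Matrix (Fin k) (Fin d) ℝ)
    {x : Fin n → EuclideanSpace ℝ (Fin d)}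
    (hx : ∀ r : Fin n → ℝ, (∀ b, ∑ i, r i * inner ℝ b (x i) ^ 2 = 0) → r = 0)
    {w : EuclideanSpace ℝ (Fin k × Fin d)} (hg : gradient (plantedLoss v vs Ws x) w = 0)
    (hh : ∀ u, 0 ≤ hessForm (plantedLoss v vs Ws x) w u) :
    plantedLoss v vs Ws x w = 0 := by
  have hn' : (0 : ℝ) < n := by positivity
  unfold plantedLoss at *
  set y := plantedLabels vs Ws x with hy
  set r : Fin n → ℝ := fun i => quadNet v (unvec w) (x i) - y i with hr
  have hg' : ∀ u, ∑ i, r i * netBilin v (x i) w u = 0 := by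
    intro u
    have h := inner_gradient_trainLoss v x y w u
    rw [hg, inner_zero_left] at h
    have h2 : (2 : ℝ) / n ≠ 0 := by positivity
    exact (mul_eq_zero.1 h.symm).resolve_left h2
  by_cases hli : LinearIndependent ℝ fun l : {l // v l ≠ 0} => WithLp.toLp 2 (unvec w l)
  · have hr0 : r = 0 := by
      have hspan : Submodule.span ℝ
          (Set.range fun l : {l // v l ≠ 0} => WithLp.toLp 2 (unvec w l)) = ⊤ := by
        refine hli.span_eq_top_of_card_eq_finrank' (le_antisymm ?_ ?_)
        · exact hli.fintype_card_le_finrank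
        · simpa [Nat.card_eq_fintype_card] using hcard
      refine hx r fun b => ?_
      -- The gradient equation says that `∑ rᵢ xᵢ xᵢᵀ` kills each active row; these rows span.
      have key : ∀ c : EuclideanSpace ℝ (Fin d),
          ∑ i, r i * (inner ℝ c (x i) * inner ℝ b (x i)) = 0 := by
        intro c
        have hc : c ∈ Submodule.span ℝ
          (Set.range fun l : {l // v l ≠ 0} => WithLp.toLp 2 (unvec w l)) := hspan ▸ trivial
        induction hc using Submodule.span_induction with
        | mem c hc =>
          obtain ⟨⟨l, hl⟩, rfl⟩ := hc
          have h := hg' (vecOuter (Pi.single l 1) b)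
          simp only [netBilin_vecOuter, Pi.single_apply, mul_ite, mul_one, mul_zero, ite_smul,
            zero_smul, Finset.sum_ite_eq', Finset.mem_univ, if_true, real_inner_smul_left] at h
          have h' : v l * ∑ i, r i * (inner ℝ (WithLp.toLp 2 (unvec w l)) (x i) *
              inner ℝ b (x i)) = 0 := by
            rw [← h, Finset.mul_sum]
            exact Finset.sum_congr rfl fun _ _ => by ring
          exact (mul_eq_zero.1 h').resolve_left hl
        | zero => simp
        | add c e _ _ hc he =>
          simp only [inner_add_left, add_mul, mul_add, Finset.sum_add_distrib, hc, he, add_zero]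
        | smul t c _ hc =>
          rw [← mul_zero t, ← hc, Finset.mul_sum]
          exact Finset.sum_congr rfl fun _ _ => by rw [real_inner_smul_left]; ring
      simpa [sq] using key b
    rw [trainLoss_eq]
    have : ∀ i, quadNet v (unvec w) (x i) - y i = 0 := fun i => congrFun hr0 i
    simp [this]
  · obtain ⟨g, hg0, l₀, hl₀⟩ := Fintype.not_linearIndependent_iff.1 hli
    -- Dividing by `v l` turns the dependence `g` among active rows into the relation required by
    -- `hessForm_vecOuter`.
    let a : Fin k → ℝ := fun l => if h : v l ≠ 0 then g ⟨l, h⟩ / v l else 0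
    have ha : ∑ l, (v l * a l) • WithLp.toLp 2 (unvec w l) = 0 := by
      rw [← hg0, ← Finset.sum_filter_of_ne (p := fun l => v l ≠ 0)
        (fun l _ h hl => h (by rw [hl, zero_mul, zero_smul])),
        Finset.sum_subtype _ (p := fun l => v l ≠ 0) (by simp)]
      refine Finset.sum_congr rfl fun l _ => ?_
      have h : v l * a l = g l := by simp [a, l.2, mul_div_cancel₀]
      rw [h]
    have hpos : 0 < ∑ l, v l * a l ^ 2 := by
      refine Finset.sum_pos' (fun l _ => mul_nonneg (hv l) (sq_nonneg _)) ⟨l₀, Finset.mem_univ _, ?_⟩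
      have h1 : 0 < v l₀ := lt_of_le_of_ne (hv _) (Ne.symm l₀.2)
      have h2 : a l₀ ≠ 0 := by simp [a, l₀.2, hl₀]
      positivity
    have hM : ∀ b : EuclideanSpace ℝ (Fin d), 0 ≤ ∑ i, r i * inner ℝ b (x i) ^ 2 := by
      intro b
      have h := hh (vecOuter a b)
      rw [hessForm_vecOuter v x y ha b] at h
      exact nonneg_of_mul_nonneg_right (nonneg_of_mul_nonneg_right h (by positivity)) hpos
    refine le_antisymm ?_ (trainLoss_nonneg v x y w)
    -- The direction `u = w` gives `∑ rᵢ qᵢ = 0`.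
    have h1 := hg' w
    simp only [netBilin_self] at h1
    have h2 : 0 ≤ ∑ i, r i * y i := by
      rw [hy, sum_mul_plantedLabels]
      exact Finset.sum_nonneg fun l _ => mul_nonneg (hvs l) (hM _)
    rw [trainLoss_eq]
    refine mul_nonpos_of_nonneg_of_nonpos (by positivity) ?_
    simp only [hr] at h1 h2
    linarith

end Landscape

/-! ### Generic inputs and interpolation -/

section Generic

variable {n k d : ℕ}

/-- The Gram matrix of the rank-one matrices `xᵢ xᵢᵀ`. -/
noncomputable def sqGram (x : Fin n → EuclideanSpace ℝ (Fin d)) : Matrix (Fin n) (Fin n) ℝ :=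
  Matrix.of fun i j => inner ℝ (x i) (x j) ^ 2

theorem continuous_det_sqGram :
    Continuous fun x : Fin n → EuclideanSpace ℝ (Fin d) => (sqGram x).det := by
  refine Continuous.matrix_det (continuous_matrix fun i j => ?_)
  simp only [sqGram, Matrix.of_apply]
  fun_prop

theorem sqGram_smul (t : ℝ) (x : Fin n → EuclideanSpace ℝ (Fin d)) :
    sqGram (t • x) = t ^ 4 • sqGram x := by
  ext i j
  simp only [sqGram, Matrix.of_apply, Pi.smul_apply, real_inner_smul_left, real_inner_smul_right,
    Matrix.smul_apply, smul_eq_mul]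
  ring

/-- Taking `b = x j` in `hr` gives the entry `j` of `sqGram x *ᵥ r`. -/
theorem eq_zero_of_det_sqGram_ne_zero {x : Fin n → EuclideanSpace ℝ (Fin d)}
    (hx : (sqGram x).det ≠ 0) (r : Fin n → ℝ) (hr : ∀ b, ∑ i, r i * inner ℝ b (x i) ^ 2 = 0) :
    r = 0 := by
  refine Matrix.eq_zero_of_mulVec_eq_zero hx (funext fun j => ?_)
  simpa [Matrix.mulVec, dotProduct, sqGram, mul_comm] using hr (x j)

/-- There are `d.choose 2` vectors whose outer squares are linearly independent. -/
theorem exists_det_sqGram_ne_zero (h : n ≤ d.choose 2) :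
    ∃ x : Fin n → EuclideanSpace ℝ (Fin d), (sqGram x).det ≠ 0 := by
  have hcard : Fintype.card (Fin n) ≤
      Fintype.card {s // s ∈ Finset.powersetCard 2 (Finset.univ : Finset (Fin d))} := by
    simpa [Finset.card_powersetCard] using h
  obtain ⟨e⟩ := Function.Embedding.nonempty_of_card_le hcard
  -- Indicator vectors of distinct pairs `{a, b}`: the entry `(a, b)` of the outer squares is
  -- nonzero for that pair alone.
  let x : Fin n → EuclideanSpace ℝ (Fin d) := fun i =>
    WithLp.toLp 2 fun a => if a ∈ (e i).1 then 1 else 0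
  refine ⟨x, fun hdet => ?_⟩
  obtain ⟨r, hr0, hr⟩ := Matrix.exists_mulVec_eq_zero_iff.2 hdet
  refine hr0 (funext fun i => ?_)
  -- The quadratic form of `sqGram x` at `r` is the squared Frobenius norm of `∑ rᵢ xᵢ xᵢᵀ`.
  have hsum : ∑ a, ∑ b, (∑ i, r i * (x i a * x i b)) ^ 2 = 0 := by
    have h1 : ∑ j, r j * (sqGram x *ᵥ r) j = 0 := by simp [hr]
    rw [← h1]
    simp only [sq, Finset.sum_mul_sum]
    rw [Finset.sum_comm_cycle]
    refine Finset.sum_congr rfl fun i _ => ?_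
    rw [Finset.sum_comm_cycle]
    simp only [Matrix.mulVec, dotProduct, sqGram, Matrix.of_apply, PiLp.inner_apply, sq,
      Finset.mul_sum, RCLike.inner_apply, conj_trivial, Finset.sum_mul]
    exact Finset.sum_congr rfl fun _ _ => Finset.sum_congr rfl fun _ _ =>
      Finset.sum_congr rfl fun _ _ => by ring
  obtain ⟨a, b, hab, hs⟩ := Finset.card_eq_two.1 (Finset.mem_powersetCard.1 (e i).2).2
  have h2 := (Finset.sum_eq_zero_iff_of_nonneg fun a _ =>
    Finset.sum_nonneg fun b _ => sq_nonneg _).1 hsum a (Finset.mem_univ _)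
  have h3 := (Finset.sum_eq_zero_iff_of_nonneg fun b _ => sq_nonneg _).1 h2 b (Finset.mem_univ _)
  rw [sq_eq_zero_iff, Finset.sum_eq_single i] at h3
  · simpa [x, hs] using h3
  · intro j _ hji
    have : ¬ (a ∈ (e j).1 ∧ b ∈ (e j).1) := by
      rintro ⟨ha, hb⟩
      refine hji (e.injective (Subtype.ext ?_))
      rw [hs]
      refine (Finset.eq_of_subset_of_card_le (by simp [Finset.insert_subset_iff, ha, hb]) ?_).symm
      rw [(Finset.mem_powersetCard.1 (e j).2).2, Finset.card_pair hab]
    simp only [x, mul_ite, mul_one, mul_zero, ite_eq_right_iff]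
    grind
  · simp

/-- On every line parallel to a good configuration `x₀` the determinant is a nonzero polynomial in
the parameter, so it has finitely many zeros there; a Fubini argument then gives a null set. -/
theorem ae_det_sqGram_ne_zero (h : n ≤ d.choose 2) :
    ∀ᵐ x : Fin n → EuclideanSpace ℝ (Fin d) ∂volume, (sqGram x).det ≠ 0 := by
  obtain ⟨x₀, hx₀⟩ := exists_det_sqGram_ne_zero h
  refine ae_mem_of_ae_add_linearMap_mem (LinearMap.toSpanSingleton ℝ _ x₀) volume volume
    (s := {x | (sqGram x).det ≠ 0}) ?_ fun y => ?_
  · exact (isOpen_ne.preimage continuous_det_sqGram).measurableSet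
  let P : Polynomial ℝ := Matrix.det (Matrix.of fun i j : Fin n =>
    (Polynomial.C (inner ℝ (y i) (y j)) +
      Polynomial.C (inner ℝ (y i) (x₀ j) + inner ℝ (x₀ i) (y j)) * Polynomial.X +
      Polynomial.C (inner ℝ (x₀ i) (x₀ j)) * Polynomial.X ^ 2) ^ 2)
  have hP : ∀ t : ℝ, P.eval t = (sqGram (y + t • x₀)).det := by
    intro t
    rw [← Polynomial.coe_evalRingHom, RingHom.map_det]
    congr 1
    ext i j
    simp only [sqGram, RingHom.mapMatrix_apply, Matrix.map_apply, Matrix.of_apply, Pi.add_apply,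
      Pi.smul_apply, inner_add_left, inner_add_right, real_inner_smul_left, real_inner_smul_right,
      Polynomial.coe_evalRingHom, Polynomial.eval_pow, Polynomial.eval_add, Polynomial.eval_mul,
      Polynomial.eval_C, Polynomial.eval_X]
    ring
  -- Far out on the line the determinant is, up to a power of `t` by homogeneity, its value at `x₀ +
  -- t⁻¹ • y`, which is close to `x₀`.
  have hP0 : P ≠ 0 := by
    have hc : Continuous fun s : ℝ => (sqGram (x₀ + s • y)).det :=
      continuous_det_sqGram.comp (by fun_prop)
    have hev : ∀ᶠ s in nhds (0 : ℝ), (sqGram (x₀ + s • y)).det ≠ 0 :=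
      hc.continuousAt.eventually_ne (by simpa using hx₀)
    obtain ⟨s, hs, hs0⟩ := ((hev.filter_mono (nhdsWithin_le_nhds (s := Set.Ioi 0))).and
      self_mem_nhdsWithin).exists
    have hs0 : 0 < s := hs0
    intro hP0
    have h1 := hP s⁻¹
    have h2 : y + s⁻¹ • x₀ = s⁻¹ • (x₀ + s • y) := by
      rw [smul_add, smul_smul, inv_mul_cancel₀ hs0.ne', one_smul, add_comm]
    rw [hP0, Polynomial.eval_zero, h2, sqGram_smul, Matrix.det_smul] at h1
    exact mul_ne_zero (by positivity) hs h1.symm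
  have hfin : {t : ℝ | P.eval t = 0}.Finite := by
    refine P.roots.toFinset.finite_toSet.subset fun t ht => ?_
    simpa [hP0] using ht
  filter_upwards [hfin.measure_zero volume |> compl_mem_ae_iff.2] with t ht
  simpa [hP] using ht

open scoped MatrixOrder Matrix.Norms.L2Operator in
/-- The planted network can be realized with any output weights that have `d` positive entries. -/
theorem exists_quadNet_eq {v vs : Fin k → ℝ} (hv : ∀ l, 0 ≤ v l) (hvs : ∀ l, 0 ≤ vs l)
    (hcard : d ≤ Nat.card {l // v l ≠ 0}) (Ws : Matrix (Fin k) (Fin d) ℝ) :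
    ∃ w : EuclideanSpace ℝ (Fin k × Fin d), ∀ x, quadNet v (unvec w) x = quadNet vs Ws x := by
  have hA : (Wsᵀ * Matrix.diagonal vs * Ws).PosSemidef := by
    have := (Matrix.PosSemidef.diagonal (n := Fin k) (d := vs) hvs).conjTranspose_mul_mul_same Ws
    simpa using this
  obtain ⟨B, hB⟩ := CStarAlgebra.nonneg_iff_eq_star_mul_self.1 hA.nonneg
  have hBx : ∀ x : EuclideanSpace ℝ (Fin d), quadNet vs Ws x = ∑ j, (B *ᵥ x.ofLp) j ^ 2 := by
    intro x
    have h1 : x.ofLp ⬝ᵥ (Wsᵀ * Matrix.diagonal vs * Ws) *ᵥ x.ofLp = quadNet vs Ws x := by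
      rw [← Matrix.mulVec_mulVec, ← Matrix.mulVec_mulVec, Matrix.dotProduct_mulVec,
        Matrix.vecMul_transpose]
      simp only [dotProduct, Matrix.mulVec_diagonal, quadNet]
      exact Finset.sum_congr rfl fun _ _ => by ring
    rw [← h1, hB, Matrix.star_eq_conjTranspose, Matrix.conjTranspose_eq_transpose_of_trivial, ← Matrix.mulVec_mulVec,
      Matrix.dotProduct_mulVec, Matrix.vecMul_transpose]
    simp [dotProduct, sq]
  have hcard' : Fintype.card (Fin d) ≤ Fintype.card {l // v l ≠ 0} := by
    simpa [Nat.card_eq_fintype_card] using hcard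
  obtain ⟨e⟩ := Function.Embedding.nonempty_of_card_le hcard'
  have he : Function.Injective fun j => (e j).1 := Subtype.val_injective.comp e.injective
  -- The `d` rows of `B`, rescaled by `1 / √v`, sit on `d` active neurons; all other rows are zero.
  let W : Matrix (Fin k) (Fin d) ℝ := fun l =>
    (√(v l))⁻¹ • Function.extend (fun j => (e j).1) (fun j i => B j i) 0 l
  refine ⟨WithLp.toLp 2 fun p => W p.1 p.2, fun x => ?_⟩
  have hW : unvec (WithLp.toLp 2 fun p : Fin k × Fin d => W p.1 p.2) = W := rfl
  rw [hW, hBx, quadNet]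
  symm
  refine Fintype.sum_of_injective _ he _ _ (fun l hl => ?_) fun j => ?_
  · have : (W *ᵥ x.ofLp) l = 0 := by
      have h0 : W l = 0 := by
        simp only [W]
        rw [Function.extend_apply' _ _ _ (fun h => hl h)]
        simp
      simp [Matrix.mulVec, h0]
    simp [this]
  · have h1 : 0 < v (e j) := lt_of_le_of_ne (hv _) (Ne.symm (e j).2)
    have h2 : (W *ᵥ x.ofLp) (e j) = (√(v (e j)))⁻¹ * (B *ᵥ x.ofLp) j := by
      have h0 : W (e j) = (√(v (e j)))⁻¹ • fun i => B j i := by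
        simp only [W]
        rw [he.extend_apply]
      rw [Matrix.mulVec, h0]
      exact smul_dotProduct _ _ _
    rw [h2, mul_pow, inv_pow, Real.sq_sqrt h1.le, ← mul_assoc, mul_inv_cancel₀ h1.ne', one_mul]

end Generic

/-- The landscape of the planted loss at inputs with linearly independent `xᵢ xᵢᵀ`. -/
theorem plantedLoss_landscape {n k d : ℕ} (hn : n ≠ 0) {v vs : Fin k → ℝ} (hs : SameSign vs v)
    (hcard : d ≤ Nat.card {l // v l ≠ 0}) (Ws : Matrix (Fin k) (Fin d) ℝ)
    {x : Fin n → EuclideanSpace ℝ (Fin d)} (hx : (sqGram x).det ≠ 0) :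
    (∀ w, gradient (plantedLoss v vs Ws x) w = 0 →
      (∀ u, 0 ≤ hessForm (plantedLoss v vs Ws x) w u) → plantedLoss v vs Ws x w = 0) ∧
    ∃ w, plantedLoss v vs Ws x w = 0 := by
  wlog hpos : (∀ l, 0 ≤ vs l) ∧ ∀ l, 0 ≤ v l generalizing v vs
  · have hneg := hs.resolve_left hpos
    have h := this (v := -v) (vs := -vs) (Or.inl ?_) (by simpa using hcard) ?_
    · simpa only [plantedLoss_neg] using h
    all_goals exact ⟨fun l => neg_nonneg.2 (hneg.1 l), fun l => neg_nonneg.2 (hneg.2 l)⟩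
  refine ⟨fun w hg hh => plantedLoss_eq_zero_of_stationary hn hpos.2 hpos.1 hcard Ws
    (eq_zero_of_det_sqGram_ne_zero hx) hg hh, ?_⟩
  obtain ⟨w, hw⟩ := exists_quadNet_eq hpos.2 hpos.1 hcard Ws
  exact ⟨w, by simp [plantedLoss, trainLoss, plantedLabels, hw]⟩

theorem plantedLoss_generic_landscape {n k d : ℕ} (Ws : Matrix (Fin k) (Fin d) ℝ)
    (vs v : Fin k → ℝ) (hW : 0 < sigmaMin Ws) (hs : SameSign vs v)
    (hcard : d ≤ Nat.card {l // v l ≠ 0}) (hdn : d ≤ n) (hn : (n : ℝ) ≤ 1 / 4 * (d : ℝ) ^ 2) :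
    ∀ᵐ x : Fin n → EuclideanSpace ℝ (Fin d) ∂volume,
      (∀ w, IsLocalMin (plantedLoss v vs Ws x) w →
        IsMinOn (plantedLoss v vs Ws x) Set.univ w) ∧
      (∀ w, gradient (plantedLoss v vs Ws x) w = 0 →
        ¬ IsLocalMin (plantedLoss v vs Ws x) w →
        ∃ u, hessForm (plantedLoss v vs Ws x) w u < 0) ∧
      (∃ w, IsMinOn (plantedLoss v vs Ws x) Set.univ w) ∧
      (∀ w, IsMinOn (plantedLoss v vs Ws x) Set.univ w → plantedLoss v vs Ws x w = 0) := by
  -- For `d = 0` the singular value read off by `sigmaMin` is `0`. Positivity of `d` also yields `n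
  -- ≠ 0`.
  have hd : 0 < d := by
    rcases Nat.eq_zero_or_pos d with rfl | h
    · simp [sigmaMin, LinearMap.singularValues_of_finrank_le] at hW
    · exact h
  have hchoose : n ≤ d.choose 2 := by
    have h1 : (d : ℝ) ≤ n := by exact_mod_cast hdn
    have h2 : (1 : ℝ) ≤ d := by exact_mod_cast hd
    -- From `d ≤ n ≤ d² / 4` one gets `d ≥ 4`, and `d² / 4 ≤ d (d - 1) / 2` already for `d ≥ 2`.
    have : (n : ℝ) ≤ (d.choose 2 : ℕ) := by
      rw [Nat.cast_choose_two]
      nlinarith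
    exact_mod_cast this
  filter_upwards [ae_det_sqGram_ne_zero hchoose] with x hx
  obtain ⟨hstat, w₀, hw₀⟩ := plantedLoss_landscape (by omega) hs hcard Ws hx
  have hmin : ∀ w, plantedLoss v vs Ws x w = 0 → IsMinOn (plantedLoss v vs Ws x) Set.univ w :=
    fun w hw u _ => by
      rw [hw]
      exact trainLoss_nonneg v x (plantedLabels vs Ws x) u
  refine ⟨fun w hw => hmin w ?_, fun w hg hw => ?_, ⟨w₀, hmin w₀ hw₀⟩, fun w hw => ?_⟩
  · obtain ⟨hg, hh⟩ := hessForm_nonneg_of_isLocalMin v x _ hw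
    exact hstat w hg hh
  · by_contra! hcon
    exact hw ((hmin w (hstat w hg hcon)).isLocalMin Filter.univ_mem)
  · exact le_antisymm (hw₀ ▸ hw (Set.mem_univ w₀)) (trainLoss_nonneg v x _ w)

/-! ### Approximate local minima -/

/-- The trace is at most the nuclear norm. -/
theorem abs_trace_le_nuclearNorm {d : ℕ} (A : Matrix (Fin d) (Fin d) ℝ) :
    |A.trace| ≤ nuclearNorm A := by
  set T := Matrix.toEuclideanLin A with hT
  have hd : Module.finrank ℝ (EuclideanSpace ℝ (Fin d)) = d := by simp
  -- In an eigenbasis of `T* T` one has `‖T bᵢ‖ = σᵢ`, so each diagonal entry of `T` is at most `σᵢ`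
  -- in absolute value.
  set b := T.isPositive_adjoint_comp_self.isSymmetric.eigenvectorBasis hd with hb
  have htr : A.trace = ∑ i, inner ℝ (b i) (T (b i)) := by
    rw [← LinearMap.trace_eq_sum_inner T b]
    rw [hT, Matrix.toEuclideanLin_eq_toLin_orthonormal, Matrix.trace_toLin_eq]
  have hnorm : ∀ i, ‖T (b i)‖ = T.singularValues i := by
    intro i
    rw [LinearMap.singularValues_fin T hd, ← Real.sqrt_sq (norm_nonneg (T (b i)))]
    congr 1
    rw [← real_inner_self_eq_norm_sq, ← LinearMap.adjoint_inner_left, ← LinearMap.comp_apply,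
      hb, LinearMap.IsSymmetric.apply_eigenvectorBasis, ← hb, inner_smul_left,
      real_inner_self_eq_norm_sq, b.norm_eq_one]
    simp
  rw [htr, nuclearNorm, ← Fin.sum_univ_eq_sum_range (fun i => T.singularValues i)]
  refine (Finset.abs_sum_le_sum_abs _ _).trans (Finset.sum_le_sum fun i _ => ?_)
  rw [← hnorm]
  simpa [b.norm_eq_one] using abs_real_inner_le_norm (b i) (T (b i))

theorem trace_transpose_mul_diagonal_mul {k d : ℕ} (vs : Fin k → ℝ)
    (Ws : Matrix (Fin k) (Fin d) ℝ) :
    (Wsᵀ * Matrix.diagonal vs * Ws).trace = ∑ l, vs l * ‖WithLp.toLp 2 (Ws l)‖ ^ 2 := by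
  rw [Matrix.mul_assoc, Matrix.trace_mul_comm, Matrix.mul_assoc, Matrix.trace]
  refine Finset.sum_congr rfl fun l _ => ?_
  rw [Matrix.diag_apply, Matrix.diagonal_mul, EuclideanSpace.real_norm_sq_eq, Matrix.mul_apply]
  simp [sq]

section Approx

variable {n k d : ℕ}

/-- Here `s` is the root mean square of the outputs, `T = ν ‖w‖²` and `e = εg / √ν`. If `√T > 16 e`,
then `e √T / 2 ≤ T / 32 ≤ s / 2`; cancelling `s` leaves `T / 16 ≤ s ≤ 1/2 + 14 a`. -/
theorem loss_bound_real {s T a e : ℝ} (hs : 0 ≤ s) (hT : T ≤ 16 * s) (hT0 : 0 ≤ T) (ha : 0 ≤ a)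
    (he : 0 ≤ e) (h : s ^ 2 ≤ e * √T / 2 + 14 * a * s) :
    √T / 4 ≤ max (√(1 + 14 * a)) (4 * e) := by
  by_cases hc : √T / 4 ≤ 4 * e
  · exact hc.trans (le_max_right _ _)
  push Not at hc
  refine le_trans ?_ (le_max_left _ _)
  have hsq := Real.sq_sqrt hT0
  have h0 := Real.sqrt_nonneg T
  have h1 : e * √T ≤ T / 16 := by nlinarith
  have h2 : s * s ≤ s * (1 / 2 + 14 * a) := by nlinarith
  refine Real.le_sqrt_of_sq_le ?_
  rcases hs.eq_or_lt with rfl | hs'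
  · nlinarith
  · have := le_of_mul_le_mul_left h2 hs'
    nlinarith

/-- The bound on the loss at an approximate local minimum, for well-conditioned inputs. -/
theorem plantedLoss_le_of_isApproxLocalMin (hn : n ≠ 0) (hdk : d < k) {ν : ℝ} (hν : 0 < ν)
    {vs : Fin k → ℝ} (hvs : ∀ l, 0 ≤ vs l) (Ws : Matrix (Fin k) (Fin d) ℝ)
    {x : Fin n → EuclideanSpace ℝ (Fin d)} {a : ℝ}
    (ha : a = ∑ l, vs l * ‖WithLp.toLp 2 (Ws l)‖ ^ 2)
    (hx : ∀ u : EuclideanSpace ℝ (Fin d), n * ‖u‖ ^ 2 ≤ 16 * ∑ i, inner ℝ u (x i) ^ 2)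
    (hy : ∑ i, plantedLabels vs Ws x i ^ 2 ≤ n * (14 * a) ^ 2)
    {εg εH : ℝ} (hg0 : 0 ≤ εg) (hH0 : 0 ≤ εH) {w : EuclideanSpace ℝ (Fin k × Fin d)}
    (hw : IsApproxLocalMin (plantedLoss (fun _ => ν) vs Ws x) εg εH w) :
    plantedLoss (fun _ => ν) vs Ws x w ≤
      εg / √ν * max (√(1 + 14 * a)) (4 * (εg / √ν)) + εH / (2 * ν) * a := by
  obtain ⟨hg, hh⟩ := hw
  have hn' : (0 : ℝ) < n := by positivity
  have ha0 : 0 ≤ a := ha ▸ Finset.sum_nonneg fun l _ => mul_nonneg (hvs l) (by positivity)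
  unfold plantedLoss at *
  set y := plantedLabels vs Ws x with hydef
  set q : Fin n → ℝ := fun i => quadNet (fun _ => ν) (unvec w) (x i) with hq
  -- curvature in the directions `c bᵀ` with `c` in the left kernel of the weights
  have hM : ∀ b : EuclideanSpace ℝ (Fin d),
      -(n * εH / (2 * ν)) * ‖b‖ ^ 2 ≤ ∑ i, (q i - y i) * inner ℝ b (x i) ^ 2 := by
    -- There are `k > d` rows in dimension `d`, so no case distinction is needed here.
    have hdep : ¬ LinearIndependent ℝ fun l : Fin k => WithLp.toLp 2 (unvec w l) := by
      intro hli
      have := hli.fintype_card_le_finrank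
      simp at this
      omega
    obtain ⟨c, hc0, l₀, hl₀⟩ := Fintype.not_linearIndependent_iff.1 hdep
    have hc : ∑ l, (ν * c l) • WithLp.toLp 2 (unvec w l) = 0 := by
      simp only [mul_smul, ← Finset.smul_sum, hc0, smul_zero]
    have hcpos : 0 < ∑ l, c l ^ 2 :=
      Finset.sum_pos' (fun l _ => sq_nonneg _) ⟨l₀, Finset.mem_univ _, by positivity⟩
    intro b
    have h := hh (vecOuter c b)
    rw [hessForm_vecOuter _ x y hc b, norm_vecOuter_sq, ← Finset.mul_sum] at h
    have h' : (∑ l, c l ^ 2) * (-εH * ‖b‖ ^ 2) ≤ (∑ l, c l ^ 2) * (2 / (n : ℝ) * ν *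
        ∑ i, (q i - y i) * inner ℝ b (x i) ^ 2) := by
      calc _ = -εH * ((∑ l, c l ^ 2) * ‖b‖ ^ 2) := by ring
        _ ≤ _ := h
        _ = _ := by simp only [hq]; ring
    have h2 := le_of_mul_le_mul_left h' hcpos
    have h3 : 0 ≤ n / (2 * ν) := by positivity
    calc _ = n / (2 * ν) * (-εH * ‖b‖ ^ 2) := by ring
      _ ≤ n / (2 * ν) * (2 / (n : ℝ) * ν * ∑ i, (q i - y i) * inner ℝ b (x i) ^ 2) :=
        mul_le_mul_of_nonneg_left h2 h3
      _ = _ := by field_simp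
  have hyM : -(n * εH / (2 * ν)) * a ≤ ∑ i, (q i - y i) * y i := by
    have h1 := sum_mul_plantedLabels vs Ws x fun i => q i - y i
    rw [← hydef] at h1
    rw [h1, ha, Finset.mul_sum]
    refine Finset.sum_le_sum fun l _ => ?_
    calc _ = vs l * (-(n * εH / (2 * ν)) * ‖WithLp.toLp 2 (Ws l)‖ ^ 2) := by ring
      _ ≤ _ := mul_le_mul_of_nonneg_left (hM _) (hvs l)
  -- the radial derivative
  have hrad : ∑ i, (q i - y i) * q i ≤ n / 2 * (εg * ‖w‖) := by
    have h1 := (real_inner_le_norm _ w).trans (mul_le_mul_of_nonneg_right hg (norm_nonneg w))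
    rw [inner_gradient_trainLoss] at h1
    simp only [netBilin_self] at h1
    calc _ = n / 2 * (2 / (n : ℝ) * ∑ i, (q i - y i) * q i) := by field_simp
      _ ≤ _ := mul_le_mul_of_nonneg_left h1 (by positivity)
  set T := ν * ‖w‖ ^ 2 with hT
  set e := εg / √ν with he
  have hsν := Real.sqrt_pos.2 hν
  have heT : εg * ‖w‖ = e * √T := by
    rw [hT, Real.sqrt_mul hν.le, Real.sqrt_sq (norm_nonneg w), he]
    field_simp
  have hqT : n * T ≤ 16 * ∑ i, q i := by
    simp only [hq, quadNet_eq_inner]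
    rw [Finset.sum_comm, hT, norm_sq_eq_sum_rows, Finset.mul_sum, Finset.mul_sum, Finset.mul_sum]
    refine Finset.sum_le_sum fun l _ => ?_
    rw [← Finset.mul_sum]
    calc _ = ν * (n * ‖WithLp.toLp 2 (unvec w l)‖ ^ 2) := by ring
      _ ≤ ν * (16 * ∑ i, inner ℝ (WithLp.toLp 2 (unvec w l)) (x i) ^ 2) :=
        mul_le_mul_of_nonneg_left (hx _) hν.le
      _ = _ := by ring
  set s := √((∑ i, q i ^ 2) / n) with hsdef
  have hs2 : n * s ^ 2 = ∑ i, q i ^ 2 := by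
    rw [hsdef, Real.sq_sqrt (by positivity)]
    field_simp
  have hs0 : 0 ≤ s := Real.sqrt_nonneg _
  have hqs : ∑ i, q i ≤ n * s := by
    refine abs_le_of_sq_le_sq' ?_ (by positivity) |>.2
    have h := sq_sum_le_card_mul_sum_sq (s := Finset.univ) (f := q)
    rw [Finset.card_univ, Fintype.card_fin, ← hs2] at h
    linarith
  have hqy : ∑ i, q i * y i ≤ n * s * (14 * a) := by
    refine abs_le_of_sq_le_sq' ?_ (by positivity) |>.2
    have h := Finset.sum_mul_sq_le_sq_mul_sq Finset.univ q y
    rw [← hs2] at h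
    calc _ ≤ _ := h
      _ ≤ n * s ^ 2 * (n * (14 * a) ^ 2) := mul_le_mul_of_nonneg_left hy (by positivity)
      _ = _ := by ring
  have hkey := loss_bound_real (s := s) (T := T) (a := a) (e := e) hs0 ?_ (by positivity) ha0
    (by positivity) ?_
  · rw [trainLoss_eq]
    have h1 : 1 / (2 * (n : ℝ)) * (∑ i, (q i - y i) * q i - ∑ i, (q i - y i) * y i) ≤
        1 / (2 * (n : ℝ)) * (n / 2 * (e * √T) + n * εH / (2 * ν) * a) := by
      rw [← heT]
      exact mul_le_mul_of_nonneg_left (by linarith) (by positivity)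
    have h2 : 1 / (2 * (n : ℝ)) * (n / 2 * (e * √T) + n * εH / (2 * ν) * a) =
        e * (√T / 4) + εH / (2 * ν) * a / 2 := by
      field_simp
      ring
    have h3 : e * (√T / 4) ≤ e * max (√(1 + 14 * a)) (4 * e) :=
      mul_le_mul_of_nonneg_left hkey (by positivity)
    have h4 : 0 ≤ εH / (2 * ν) * a := by positivity
    linarith
  · have : n * T ≤ n * (16 * s) := by linarith
    exact le_of_mul_le_mul_left this hn'
  · have h1 : ∑ i, (q i - y i) * q i = n * s ^ 2 - ∑ i, q i * y i := by
      rw [hs2, ← Finset.sum_sub_distrib]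
      exact Finset.sum_congr rfl fun _ _ => by ring
    rw [h1, heT] at hrad
    have : n * s ^ 2 ≤ n * (e * √T / 2 + 14 * a * s) := by linarith
    exact le_of_mul_le_mul_left this hn'

end Approx

/-! ### One-dimensional marginals of the standard Gaussian -/

section Marginals

/-- The value is `1 / √(1 + 2·4)`; the exponent `4` makes it rational. It feeds the Chernoff bound.
-/
theorem integral_exp_neg_four_sq_gaussianReal :
    ∫ t, Real.exp (-4 * t ^ 2) ∂gaussianReal 0 1 = 1 / 3 := by
  rw [integral_gaussianReal_eq_integral_smul one_ne_zero]
  have h : ∀ t : ℝ, gaussianPDFReal 0 1 t • Real.exp (-4 * t ^ 2) =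
      (√(2 * Real.pi))⁻¹ * Real.exp (-(9 / 2) * t ^ 2) := by
    intro t
    rw [gaussianPDFReal_def]
    simp only [NNReal.coe_one, mul_one, sub_zero, smul_eq_mul]
    rw [mul_assoc, ← Real.exp_add]
    congr 2
    ring
  simp_rw [h]
  rw [integral_const_mul, integral_gaussian, ← Real.sqrt_inv, ← Real.sqrt_mul (by positivity)]
  have h2 : (2 * Real.pi)⁻¹ * (Real.pi / (9 / 2)) = (1 / 3) ^ 2 := by
    field_simp
    norm_num
  rw [h2, Real.sqrt_sq (by norm_num)]

theorem integrable_pow_gaussianReal (p : ℕ) :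
    Integrable (fun t : ℝ => t ^ p) (gaussianReal 0 1) := by
  rcases Nat.eq_zero_or_pos p with rfl | hp
  · simp
  · have h := (memLp_id_gaussianReal (μ := 0) (v := 1) (p : NNReal)).integrable_norm_pow hp.ne'
    refine h.mono (by fun_prop) (Filter.Eventually.of_forall fun t => ?_)
    simp

theorem integral_sq_gaussianReal : ∫ t, t ^ 2 ∂gaussianReal 0 1 = 1 := by
  have h := variance_fun_id_gaussianReal (μ := 0) (v := 1)
  rw [variance_eq_integral (by fun_prop)] at h
  simpa [integral_id_gaussianReal] using h

theorem integral_even_pow_gaussianReal_le {p : ℕ} (hp : Even p) :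
    ∫ t, t ^ p ∂gaussianReal 0 1 ≤ 4 * p.factorial := by
  have hint : ∀ s : ℝ, Integrable (fun t => Real.exp (s * t)) (gaussianReal 0 1) :=
    fun s => integrable_exp_mul_gaussianReal s
  have hval : ∀ s : ℝ, ∫ t, Real.exp (s * t) ∂gaussianReal 0 1 = Real.exp (s ^ 2 / 2) := by
    intro s
    have := congrFun (mgf_fun_id_gaussianReal (μ := 0) (v := 1)) s
    simpa [mgf] using this
  -- One term of the exponential series of `|t|` dominates the power; the two exponentials then
  -- contribute `2 √e ≤ 4`.
  have hle : ∀ t : ℝ, t ^ p ≤ p.factorial * (Real.exp (1 * t) + Real.exp (-1 * t)) := by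
    intro t
    have h1 := Real.pow_div_factorial_le_exp |t| (abs_nonneg t) p
    rw [hp.pow_abs, div_le_iff₀ (by positivity)] at h1
    have h2 : Real.exp |t| ≤ Real.exp (1 * t) + Real.exp (-1 * t) := by
      have := Real.exp_pos (1 * t)
      have := Real.exp_pos (-1 * t)
      rcases abs_cases t with h | h <;> rw [h.1] <;> simp at * <;> linarith
    calc t ^ p ≤ Real.exp |t| * p.factorial := h1
      _ ≤ _ := by rw [mul_comm]; gcongr
  have hexp : Real.exp (1 / 2) ≤ 2 := by
    have h1 : Real.exp (1 / 2) ^ 2 = Real.exp 1 := by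
      rw [← Real.exp_nat_mul]; norm_num
    have h2 := Real.exp_one_lt_d9
    nlinarith [Real.exp_pos (1 / 2)]
  calc _ ≤ ∫ t, p.factorial * (Real.exp (1 * t) + Real.exp (-1 * t)) ∂gaussianReal 0 1 :=
        integral_mono (integrable_pow_gaussianReal p)
          (((hint 1).add (hint (-1))).const_mul _) hle
    _ = p.factorial * (Real.exp (1 / 2) + Real.exp (1 / 2)) := by
        rw [integral_const_mul, integral_add (hint 1) (hint (-1)), hval, hval]
        norm_num
    _ ≤ p.factorial * 4 := by gcongr; linarith
    _ = _ := mul_comm _ _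

variable {d : ℕ}

/-- Writing the marginal `N(0, ‖u‖²)` as a dilation of `N(0, 1)` covers `u = 0` as well. -/
theorem map_inner_stdGaussian (u : EuclideanSpace ℝ (Fin d)) :
    (stdGaussian (EuclideanSpace ℝ (Fin d))).map (fun x => inner ℝ u x) =
      (gaussianReal 0 1).map fun t => ‖u‖ * t := by
  have h := IsGaussian.map_eq_gaussianReal (μ := stdGaussian (EuclideanSpace ℝ (Fin d)))
    (innerSL ℝ u)
  rw [integral_strongDual_stdGaussian, variance_dual_stdGaussian, innerSL_apply_norm] at h
  rw [gaussianReal_map_const_mul]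
  refine Eq.trans h ?_
  congr 1
  · simp
  · ext
    simp [Real.coe_toNNReal _ (sq_nonneg ‖u‖)]

theorem integral_comp_inner_stdGaussian (u : EuclideanSpace ℝ (Fin d)) {g : ℝ → ℝ}
    (hg : Measurable g) :
    ∫ x, g (inner ℝ u x) ∂stdGaussian (EuclideanSpace ℝ (Fin d)) =
      ∫ t, g (‖u‖ * t) ∂gaussianReal 0 1 := by
  have h1 : AEMeasurable (fun x : EuclideanSpace ℝ (Fin d) => inner ℝ u x)
      (stdGaussian (EuclideanSpace ℝ (Fin d))) := by fun_prop
  rw [← integral_map h1 hg.aestronglyMeasurable, map_inner_stdGaussian,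
    integral_map (by fun_prop) hg.aestronglyMeasurable]

theorem integral_inner_pow_stdGaussian (u : EuclideanSpace ℝ (Fin d)) (p : ℕ) :
    ∫ x, inner ℝ u x ^ p ∂stdGaussian (EuclideanSpace ℝ (Fin d)) =
      ‖u‖ ^ p * ∫ t, t ^ p ∂gaussianReal 0 1 := by
  rw [integral_comp_inner_stdGaussian u (g := fun t => t ^ p) (by fun_prop)]
  simp only [mul_pow]
  rw [integral_const_mul]

theorem integrable_inner_pow_stdGaussian (u : EuclideanSpace ℝ (Fin d)) (p : ℕ) :
    Integrable (fun x => inner ℝ u x ^ p) (stdGaussian (EuclideanSpace ℝ (Fin d))) := by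
  have h1 : AEMeasurable (fun x : EuclideanSpace ℝ (Fin d) => inner ℝ u x)
      (stdGaussian (EuclideanSpace ℝ (Fin d))) := by fun_prop
  have h2 : Integrable (fun t : ℝ => t ^ p)
      ((stdGaussian (EuclideanSpace ℝ (Fin d))).map fun x => inner ℝ u x) := by
    rw [map_inner_stdGaussian, integrable_map_measure (by fun_prop) (by fun_prop)]
    simpa [Function.comp_def, mul_pow] using (integrable_pow_gaussianReal p).const_mul (‖u‖ ^ p)
  exact (integrable_map_measure (continuous_pow p).aestronglyMeasurable h1).1 h2

theorem norm_sq_eq_sum_inner (x : EuclideanSpace ℝ (Fin d)) :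
    ‖x‖ ^ 2 = ∑ j, inner ℝ (EuclideanSpace.single j (1 : ℝ)) x ^ 2 := by
  simp [EuclideanSpace.real_norm_sq_eq, EuclideanSpace.inner_single_left]

theorem integrable_norm_sq_stdGaussian :
    Integrable (fun x => ‖x‖ ^ 2) (stdGaussian (EuclideanSpace ℝ (Fin d))) := by
  simp only [norm_sq_eq_sum_inner]
  exact integrable_finsetSum _ fun j _ => integrable_inner_pow_stdGaussian _ 2

theorem integral_norm_sq_stdGaussian :
    ∫ x, ‖x‖ ^ 2 ∂stdGaussian (EuclideanSpace ℝ (Fin d)) = d := by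
  simp only [norm_sq_eq_sum_inner]
  rw [integral_finsetSum _ fun j _ => integrable_inner_pow_stdGaussian _ 2]
  simp [integral_inner_pow_stdGaussian, integral_sq_gaussianReal]

end Marginals

/-! ### Moments of the planted network -/

section Moments

variable {k d : ℕ} {vs : Fin k → ℝ} (Ws : Matrix (Fin k) (Fin d) ℝ)

/-- Jensen's inequality, in steps of the Cauchy-Schwarz inequality. -/
theorem quadNet_pow_le (hvs : ∀ l, 0 ≤ vs l) (x : EuclideanSpace ℝ (Fin d)) :
    quadNet vs Ws x ^ 2 ≤ (∑ l, vs l * ‖WithLp.toLp 2 (Ws l)‖ ^ 2) *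
      ∑ l, vs l / ‖WithLp.toLp 2 (Ws l)‖ ^ 2 * inner ℝ (WithLp.toLp 2 (Ws l)) x ^ 4 ∧
    quadNet vs Ws x ^ 4 ≤ (∑ l, vs l * ‖WithLp.toLp 2 (Ws l)‖ ^ 2) ^ 3 *
      ∑ l, vs l / ‖WithLp.toLp 2 (Ws l)‖ ^ 6 * inner ℝ (WithLp.toLp 2 (Ws l)) x ^ 8 := by
  have h0 : ∀ l, ‖WithLp.toLp 2 (Ws l)‖ = 0 → inner ℝ (WithLp.toLp 2 (Ws l)) x = 0 := by
    intro l hl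
    rw [norm_eq_zero.1 hl, inner_zero_left]
  have h1 : quadNet vs Ws x ^ 2 ≤ (∑ l, vs l * ‖WithLp.toLp 2 (Ws l)‖ ^ 2) *
      ∑ l, vs l / ‖WithLp.toLp 2 (Ws l)‖ ^ 2 * inner ℝ (WithLp.toLp 2 (Ws l)) x ^ 4 := by
    rw [quadNet_eq_inner]
    refine Finset.sum_sq_le_sum_mul_sum_of_sq_le_mul _
      (fun l _ => mul_nonneg (hvs l) (by positivity))
      (fun l _ => mul_nonneg (div_nonneg (hvs l) (by positivity)) (by positivity)) fun l _ => ?_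
    -- A zero row has weight `vs l / 0 = 0` and contributes nothing to either side.
    by_cases hl : ‖WithLp.toLp 2 (Ws l)‖ = 0
    · simp [h0 l hl]
    · refine le_of_eq ?_
      field_simp
  have h2 : (∑ l, vs l / ‖WithLp.toLp 2 (Ws l)‖ ^ 2 * inner ℝ (WithLp.toLp 2 (Ws l)) x ^ 4) ^ 2 ≤
      (∑ l, vs l * ‖WithLp.toLp 2 (Ws l)‖ ^ 2) *
      ∑ l, vs l / ‖WithLp.toLp 2 (Ws l)‖ ^ 6 * inner ℝ (WithLp.toLp 2 (Ws l)) x ^ 8 := by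
    refine Finset.sum_sq_le_sum_mul_sum_of_sq_le_mul _
      (fun l _ => mul_nonneg (hvs l) (by positivity))
      (fun l _ => mul_nonneg (div_nonneg (hvs l) (by positivity)) (by positivity)) fun l _ => ?_
    by_cases hl : ‖WithLp.toLp 2 (Ws l)‖ = 0
    · simp [h0 l hl]
    · refine le_of_eq ?_
      field_simp
  refine ⟨h1, ?_⟩
  calc quadNet vs Ws x ^ 4 = (quadNet vs Ws x ^ 2) ^ 2 := by ring
    _ ≤ _ := pow_le_pow_left₀ (sq_nonneg _) h1 2
    _ = _ := mul_pow _ _ 2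
    _ ≤ _ := mul_le_mul_of_nonneg_left h2 (sq_nonneg _)
    _ = _ := by ring

theorem continuous_quadNet (v : Fin k → ℝ) : Continuous fun x => quadNet v Ws x := by
  simp only [quadNet_eq_inner]
  fun_prop

theorem integral_weighted_inner_pow_le (hvs : ∀ l, 0 ≤ vs l) {p : ℕ} (hp : Even p) :
    ∫ x, ∑ l, vs l / ‖WithLp.toLp 2 (Ws l)‖ ^ p * inner ℝ (WithLp.toLp 2 (Ws l)) x ^ (p + 2)
      ∂stdGaussian (EuclideanSpace ℝ (Fin d)) ≤
    4 * (p + 2).factorial * ∑ l, vs l * ‖WithLp.toLp 2 (Ws l)‖ ^ 2 := by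
  rw [integral_finsetSum _ fun l _ => (integrable_inner_pow_stdGaussian _ _).const_mul _,
    Finset.mul_sum]
  refine Finset.sum_le_sum fun l _ => ?_
  rw [integral_const_mul, integral_inner_pow_stdGaussian]
  by_cases hl : ‖WithLp.toLp 2 (Ws l)‖ = 0
  · simp [hl]
  · have h := integral_even_pow_gaussianReal_le (hp.add even_two)
    calc _ = vs l * ‖WithLp.toLp 2 (Ws l)‖ ^ 2 * ∫ t, t ^ (p + 2) ∂gaussianReal 0 1 := by
          rw [pow_add]; field_simp
      _ ≤ vs l * ‖WithLp.toLp 2 (Ws l)‖ ^ 2 * (4 * (p + 2).factorial) :=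
          mul_le_mul_of_nonneg_left h (mul_nonneg (hvs l) (by positivity))
      _ = _ := mul_comm _ _

theorem quadNet_moments (hvs : ∀ l, 0 ≤ vs l) :
    Integrable (fun x => quadNet vs Ws x ^ 4) (stdGaussian (EuclideanSpace ℝ (Fin d))) ∧
    ∫ x, quadNet vs Ws x ^ 2 ∂stdGaussian (EuclideanSpace ℝ (Fin d)) ≤
      96 * (∑ l, vs l * ‖WithLp.toLp 2 (Ws l)‖ ^ 2) ^ 2 ∧
    ∫ x, quadNet vs Ws x ^ 4 ∂stdGaussian (EuclideanSpace ℝ (Fin d)) ≤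
      161280 * (∑ l, vs l * ‖WithLp.toLp 2 (Ws l)‖ ^ 2) ^ 4 := by
  have hc := continuous_quadNet Ws vs
  set a := ∑ l, vs l * ‖WithLp.toLp 2 (Ws l)‖ ^ 2 with ha
  have ha0 : 0 ≤ a := Finset.sum_nonneg fun l _ => mul_nonneg (hvs l) (by positivity)
  have hi : ∀ p q : ℕ, Integrable (fun x => ∑ l, vs l / ‖WithLp.toLp 2 (Ws l)‖ ^ p *
      inner ℝ (WithLp.toLp 2 (Ws l)) x ^ q) (stdGaussian (EuclideanSpace ℝ (Fin d))) :=
    fun p q => integrable_finsetSum _ fun l _ => (integrable_inner_pow_stdGaussian _ _).const_mul _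
  have hle := quadNet_pow_le Ws hvs
  have hint4 : Integrable (fun x => quadNet vs Ws x ^ 4)
      (stdGaussian (EuclideanSpace ℝ (Fin d))) := by
    refine ((hi 6 8).const_mul (a ^ 3)).mono' (by fun_prop) (Filter.Eventually.of_forall fun x => ?_)
    rw [Real.norm_of_nonneg (by positivity)]
    exact (hle x).2
  have hint2 : Integrable (fun x => quadNet vs Ws x ^ 2)
      (stdGaussian (EuclideanSpace ℝ (Fin d))) := by
    refine ((hi 2 4).const_mul a).mono' (by fun_prop) (Filter.Eventually.of_forall fun x => ?_)
    rw [Real.norm_of_nonneg (by positivity)]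
    exact (hle x).1
  refine ⟨hint4, ?_, ?_⟩
  · calc _ ≤ _ := integral_mono hint2 ((hi 2 4).const_mul a) fun x => (hle x).1
      _ = _ := integral_const_mul _ _
      _ ≤ a * (4 * (2 + 2).factorial * a) :=
        mul_le_mul_of_nonneg_left (integral_weighted_inner_pow_le Ws hvs even_two) ha0
      _ = _ := by norm_num [Nat.factorial]; ring
  · calc _ ≤ _ := integral_mono hint4 ((hi 6 8).const_mul (a ^ 3)) fun x => (hle x).2
      _ = _ := integral_const_mul _ _
      _ ≤ a ^ 3 * (4 * (6 + 2).factorial * a) :=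
        mul_le_mul_of_nonneg_left (integral_weighted_inner_pow_le Ws hvs (by decide))
          (by positivity)
      _ = _ := by norm_num [Nat.factorial]; ring

end Moments

/-! ### Gaussian inputs are well conditioned with high probability -/

section Events

instance isProbabilityMeasure_gaussianData {n d : ℕ} : IsProbabilityMeasure (gaussianData n d) := by
  unfold gaussianData; infer_instance

variable {n k d : ℕ}

theorem gaussianData_norm_sq_large (hn : n ≠ 0) (hd : d ≠ 0) :
    (gaussianData n d).real {x | ¬ ∑ i, ‖x i‖ ^ 2 ≤ n * (d : ℝ) ^ 2} ≤ 1 / d := by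
  have hint : ∀ i, Integrable (fun x : Fin n → EuclideanSpace ℝ (Fin d) => ‖x i‖ ^ 2)
      (gaussianData n d) := fun i =>
    integrable_comp_eval (f := fun z : EuclideanSpace ℝ (Fin d) => ‖z‖ ^ 2)
      (μ := fun _ => stdGaussian (EuclideanSpace ℝ (Fin d))) integrable_norm_sq_stdGaussian
  have hval : ∫ x, ∑ i, ‖x i‖ ^ 2 ∂gaussianData n d = n * d := by
    rw [integral_finsetSum _ fun i _ => hint i]
    have : ∀ i, ∫ x, ‖x i‖ ^ 2 ∂gaussianData n d = d := fun i =>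
      (integral_comp_eval (i := i) (f := fun z : EuclideanSpace ℝ (Fin d) => ‖z‖ ^ 2)
        (μ := fun _ => stdGaussian (EuclideanSpace ℝ (Fin d))) (by fun_prop)).trans integral_norm_sq_stdGaussian
    simp [this]
  have h := mul_meas_ge_le_integral_of_nonneg (μ := gaussianData n d)
    (f := fun x => ∑ i, ‖x i‖ ^ 2)
    (Filter.Eventually.of_forall fun x => Finset.sum_nonneg fun i _ => sq_nonneg _)
    (integrable_finsetSum _ fun i _ => hint i) (n * (d : ℝ) ^ 2)
  rw [hval] at h
  have hmono : (gaussianData n d).real {x | ¬ ∑ i, ‖x i‖ ^ 2 ≤ n * (d : ℝ) ^ 2} ≤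
      (gaussianData n d).real {x | n * (d : ℝ) ^ 2 ≤ ∑ i, ‖x i‖ ^ 2} :=
    measureReal_mono fun x hx => (not_le.1 hx).le
  refine hmono.trans ?_
  have hn' : (0 : ℝ) < n := by positivity
  have hd' : (0 : ℝ) < d := by positivity
  rw [le_div_iff₀ hd']
  have h2 : (n * d : ℝ) * ((gaussianData n d).real
      {x | n * (d : ℝ) ^ 2 ≤ ∑ i, ‖x i‖ ^ 2} * d) ≤ (n * d) * 1 := by
    calc _ = n * (d : ℝ) ^ 2 * (gaussianData n d).real
          {x | n * (d : ℝ) ^ 2 ≤ ∑ i, ‖x i‖ ^ 2} := by ring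
      _ ≤ _ := h
      _ = _ := (mul_one _).symm
  exact le_of_mul_le_mul_left h2 (by positivity)

/-- Chernoff bound for the lower tail of a chi-square variable. -/
theorem gaussianData_inner_sq_small (u : EuclideanSpace ℝ (Fin d)) :
    (gaussianData n d).real {x | ¬ n * ‖u‖ ^ 2 ≤ 5 * ∑ i, inner ℝ u (x i) ^ 2} ≤
      (3 / 4) ^ n := by
  rcases eq_or_ne u 0 with rfl | hu
  · simp only [norm_zero, inner_zero_left]
    norm_num
  have hu' : 0 < ‖u‖ := norm_pos_iff.2 hu
  set f : EuclideanSpace ℝ (Fin d) → ℝ :=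
    fun z => Real.exp (-4 * (inner ℝ u z / ‖u‖) ^ 2) with hf
  have hfint : ∫ z, f z ∂stdGaussian (EuclideanSpace ℝ (Fin d)) = 1 / 3 := by
    rw [hf, integral_comp_inner_stdGaussian u (g := fun t => Real.exp (-4 * (t / ‖u‖) ^ 2))
      (by fun_prop), ← integral_exp_neg_four_sq_gaussianReal]
    simp only [mul_div_cancel_left₀ _ hu'.ne']
  have hprod : ∫ x, ∏ i, f (x i) ∂gaussianData n d = (1 / 3) ^ n := by
    rw [gaussianData, integral_fintype_prod_eq_pow, hfint, Fintype.card_fin]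
  have hbd : ∀ z, ‖f z‖ ≤ 1 := by
    intro z
    rw [hf, Real.norm_of_nonneg (Real.exp_pos _).le]
    exact Real.exp_le_one_iff.2 (by nlinarith [sq_nonneg (inner ℝ u z / ‖u‖)])
  have hint : Integrable (fun x : Fin n → EuclideanSpace ℝ (Fin d) => ∏ i, f (x i))
      (gaussianData n d) :=
    Integrable.fintype_prod (f := fun _ => f) fun _ =>
      Integrable.of_bound (by fun_prop) 1 (Filter.Eventually.of_forall hbd)
  have h := mul_meas_ge_le_integral_of_nonneg (μ := gaussianData n d)
    (f := fun x => ∏ i, f (x i))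
    (Filter.Eventually.of_forall fun x => Finset.prod_nonneg fun i _ => (Real.exp_pos _).le)
    hint (Real.exp (-(4 / 5)) ^ n)
  rw [hprod] at h
  have hmono : (gaussianData n d).real {x | ¬ n * ‖u‖ ^ 2 ≤ 5 * ∑ i, inner ℝ u (x i) ^ 2} ≤
      (gaussianData n d).real {x | Real.exp (-(4 / 5)) ^ n ≤ ∏ i, f (x i)} := by
    refine measureReal_mono fun x hx => ?_
    have hx : 5 * ∑ i, inner ℝ u (x i) ^ 2 < n * ‖u‖ ^ 2 := not_le.1 hx
    simp only [Set.mem_ofPred_eq, hf]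
    rw [← Real.exp_sum, ← Real.exp_nat_mul]
    refine Real.exp_le_exp.2 ?_
    simp only [div_pow, ← Finset.mul_sum, ← Finset.sum_div]
    have h3 : (∑ i, inner ℝ u (x i) ^ 2) / ‖u‖ ^ 2 ≤ n / 5 := by
      rw [div_le_iff₀ (by positivity)]
      linarith
    linarith
  refine hmono.trans ?_
  have hE : (0 : ℝ) < Real.exp (-(4 / 5)) ^ n := by positivity
  -- Markov's inequality bounds the probability by `(e^{4/5} / 3)^n`, and `e^{4/5} ≤ 9/4` makes the
  -- base at most `3/4`.
  have hnum : (4 : ℝ) / 9 ≤ Real.exp (-(4 / 5)) := by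
    rw [Real.exp_neg, le_inv_comm₀ (by norm_num) (Real.exp_pos _)]
    have h1 : Real.exp (4 / 5) ^ 5 = Real.exp 1 ^ 4 := by
      rw [← Real.exp_nat_mul, ← Real.exp_nat_mul]; norm_num
    refine le_of_pow_le_pow_left₀ (n := 5) (by norm_num) (by norm_num) ?_
    rw [h1]
    calc Real.exp 1 ^ 4 ≤ 2.7182818286 ^ 4 :=
          pow_le_pow_left₀ (Real.exp_pos 1).le Real.exp_one_lt_d9.le 4
      _ ≤ _ := by norm_num
  have h4 : ((1 : ℝ) / 3) ^ n ≤ Real.exp (-(4 / 5)) ^ n * (3 / 4) ^ n := by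
    rw [← mul_pow]
    exact pow_le_pow_left₀ (by norm_num) (by linarith) n
  exact le_of_mul_le_mul_left (h.trans h4) hE

/-- Chebyshev bound for the squared labels. -/
theorem gaussianData_labels_large (hn : n ≠ 0) {vs : Fin k → ℝ} (hvs : ∀ l, 0 ≤ vs l)
    (Ws : Matrix (Fin k) (Fin d) ℝ) {a : ℝ} (ha : a = ∑ l, vs l * ‖WithLp.toLp 2 (Ws l)‖ ^ 2) :
    (gaussianData n d).real {x | ¬ ∑ i, plantedLabels vs Ws x i ^ 2 ≤ n * (14 * a) ^ 2} ≤
      17 / n := by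
  have hn' : (0 : ℝ) < n := by positivity
  have ha0 : 0 ≤ a := ha ▸ Finset.sum_nonneg fun l _ => mul_nonneg (hvs l) (by positivity)
  rcases ha0.eq_or_lt with ha1 | hapos
  · have : ∀ z, quadNet vs Ws z ^ 2 ≤ 0 := fun z => by
      have := (quadNet_pow_le Ws hvs z).1
      rwa [← ha, ← ha1, zero_mul] at this
    have h2 : {x : Fin n → EuclideanSpace ℝ (Fin d) |
        ¬ ∑ i, plantedLabels vs Ws x i ^ 2 ≤ n * (14 * a) ^ 2} = ∅ := by
      refine Set.eq_empty_of_forall_notMem fun x hx => hx ?_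
      exact (Finset.sum_nonpos fun i _ => this (x i)).trans (by positivity)
    rw [h2, measureReal_empty]
    positivity
  obtain ⟨hint, hm2, hm4⟩ := quadNet_moments Ws hvs
  rw [← ha] at hm2 hm4
  have hc := continuous_quadNet Ws vs
  set F : EuclideanSpace ℝ (Fin d) → ℝ := fun z => quadNet vs Ws z ^ 2 with hF
  have hFm : AEStronglyMeasurable F (stdGaussian (EuclideanSpace ℝ (Fin d))) := by fun_prop
  have hF2 : MemLp F 2 (stdGaussian (EuclideanSpace ℝ (Fin d))) := by
    rw [memLp_two_iff_integrable_sq hFm]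
    simpa only [hF, ← pow_mul] using hint
  have hmp : ∀ i, MeasurePreserving (Function.eval i) (gaussianData n d)
      (stdGaussian (EuclideanSpace ℝ (Fin d))) := fun i => measurePreserving_eval _ i
  have hFi : ∀ i, MemLp (fun x : Fin n → EuclideanSpace ℝ (Fin d) => F (x i)) 2
      (gaussianData n d) := fun i => hF2.comp_measurePreserving (hmp i)
  have hvar1 : variance F (stdGaussian (EuclideanSpace ℝ (Fin d))) ≤ 161280 * a ^ 4 := by
    refine (variance_le_expectation_sq hFm).trans (le_of_eq_of_le ?_ hm4)
    congr 1 with z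
    simp only [hF, Pi.pow_apply, ← pow_mul]
  have hvar : variance (∑ i, fun x : Fin n → EuclideanSpace ℝ (Fin d) => F (x i))
      (gaussianData n d) ≤ n * (161280 * a ^ 4) := by
    have hind : iIndepFun (fun i (x : Fin n → EuclideanSpace ℝ (Fin d)) => F (x i))
        (gaussianData n d) := iIndepFun_pi (X := fun _ => F) fun _ => hFm.aemeasurable
    rw [IndepFun.variance_sum (fun i _ => hFi i) fun i _ j _ hij => hind.indepFun hij]
    have : ∀ i, variance (fun x : Fin n → EuclideanSpace ℝ (Fin d) => F (x i))
        (gaussianData n d) = variance F (stdGaussian (EuclideanSpace ℝ (Fin d))) := by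
      intro i
      rw [← (hmp i).map_eq, variance_map (by rw [(hmp i).map_eq]; exact hFm.aemeasurable)
        (hmp i).measurable.aemeasurable]
      rfl
    simp only [this, Finset.sum_const, Finset.card_univ, Fintype.card_fin, nsmul_eq_mul]
    exact mul_le_mul_of_nonneg_left hvar1 hn'.le
  have hmean : ∫ x, (∑ i, fun x : Fin n → EuclideanSpace ℝ (Fin d) => F (x i)) x
      ∂gaussianData n d ≤ n * (96 * a ^ 2) := by
    simp only [Finset.sum_apply]
    rw [integral_finsetSum _ fun i _ => (hFi i).integrable one_le_two]
    have : ∀ i, ∫ x, F (x i) ∂gaussianData n d =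
        ∫ z, F z ∂stdGaussian (EuclideanSpace ℝ (Fin d)) := fun i =>
      integral_comp_eval (i := i) (μ := fun _ => stdGaussian _) hFm
    simp only [this, Finset.sum_const, Finset.card_univ, Fintype.card_fin, nsmul_eq_mul]
    exact mul_le_mul_of_nonneg_left hm2 hn'.le
  -- The mean is at most `96 n a²`, and a deviation of `100 n a²` reaches `196 = 14²`.
  have hcheb := meas_ge_le_variance_div_sq (memLp_finsetSum' Finset.univ fun i _ => hFi i)
    (c := n * (100 * a ^ 2)) (by positivity)
  set S := ∑ i, fun x : Fin n → EuclideanSpace ℝ (Fin d) => F (x i) with hS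
  have hsub : {x : Fin n → EuclideanSpace ℝ (Fin d) |
      ¬ ∑ i, plantedLabels vs Ws x i ^ 2 ≤ n * (14 * a) ^ 2} ⊆
      {x | n * (100 * a ^ 2) ≤ |S x - ∫ x, S x ∂gaussianData n d|} := by
    intro x hx
    have hx : n * (14 * a) ^ 2 < ∑ i, F (x i) := not_le.1 hx
    have hSx : S x = ∑ i, F (x i) := by rw [hS, Finset.sum_apply]
    rw [Set.mem_ofPred_eq]
    refine le_trans ?_ (le_abs_self _)
    rw [hSx]
    linarith
  calc _ ≤ _ := measureReal_mono hsub
    _ ≤ variance S (gaussianData n d) / (n * (100 * a ^ 2)) ^ 2 :=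
      ENNReal.toReal_le_of_le_ofReal (div_nonneg (variance_nonneg _ _) (sq_nonneg _)) hcheb
    _ ≤ n * (161280 * a ^ 4) / (n * (100 * a ^ 2)) ^ 2 := by gcongr
    _ = 16.128 / n := by field_simp; norm_num
    _ ≤ _ := by gcongr; norm_num

end Events

/-! ### A grid on the cube -/

section Grid

/-- The points of the cube `[-1, 1]^d` with coordinates in `ℤ / N`. -/
noncomputable def gridPoint {d : ℕ} (N : ℕ) (z : Fin d → Fin (2 * N + 1)) :
    EuclideanSpace ℝ (Fin d) :=
  WithLp.toLp 2 fun j => (((z j : ℕ) : ℝ) - N) / N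

theorem exists_gridPoint_near {d N : ℕ} (hN : N ≠ 0) {v : EuclideanSpace ℝ (Fin d)}
    (hv : ‖v‖ ≤ 1) : ∃ z, ‖gridPoint N z - v‖ ^ 2 ≤ d / (N : ℝ) ^ 2 := by
  have hN' : (0 : ℝ) < N := by positivity
  -- Rounding every coordinate down to `ℤ / N` costs at most `1 / N` in each.
  have hcoord : ∀ j, |v j| ≤ 1 := fun j => (PiLp.norm_apply_le v j).trans hv
  have hz : ∀ j, ⌊(N : ℝ) * (v j + 1)⌋₊ < 2 * N + 1 := by
    intro j
    rw [Nat.lt_succ_iff]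
    refine Nat.floor_le_of_le ?_
    push_cast
    nlinarith [(abs_le.1 (hcoord j)).2]
  refine ⟨fun j => ⟨_, hz j⟩, ?_⟩
  rw [EuclideanSpace.real_norm_sq_eq]
  calc _ ≤ ∑ _j : Fin d, 1 / (N : ℝ) ^ 2 := by
        refine Finset.sum_le_sum fun j _ => ?_
        have hnn : 0 ≤ (N : ℝ) * (v j + 1) :=
          mul_nonneg hN'.le (by linarith [(abs_le.1 (hcoord j)).1])
        have h1 := Nat.floor_le hnn
        have h2 := Nat.lt_floor_add_one ((N : ℝ) * (v j + 1))
        have h3 : (gridPoint N (fun j => ⟨_, hz j⟩) - v) j =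
            (⌊(N : ℝ) * (v j + 1)⌋₊ - N * (v j + 1)) / N := by
          simp only [gridPoint, PiLp.sub_apply]
          field_simp
          ring
        rw [h3, div_pow]
        gcongr
        nlinarith
    _ = _ := by simp; ring

/-- A lower bound for the smallest eigenvalue of `∑ xᵢ xᵢᵀ` from its values on the grid. -/
theorem norm_sq_le_of_grid {n d : ℕ} (hd : d ≠ 0) {x : Fin n → EuclideanSpace ℝ (Fin d)}
    (hx : ∑ i, ‖x i‖ ^ 2 ≤ n * (d : ℝ) ^ 2)
    (hgrid : ∀ z, n * ‖gridPoint (d := d) (20 * d ^ 2) z‖ ^ 2 ≤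
      5 * ∑ i, inner ℝ (gridPoint (20 * d ^ 2) z) (x i) ^ 2) (u : EuclideanSpace ℝ (Fin d)) :
    n * ‖u‖ ^ 2 ≤ 16 * ∑ i, inner ℝ u (x i) ^ 2 := by
  rcases eq_or_ne u 0 with rfl | hu
  · simp
  have hu' : 0 < ‖u‖ := norm_pos_iff.2 hu
  set v := ‖u‖⁻¹ • u with hv
  have hv1 : ‖v‖ = 1 := by rw [hv, norm_smul, norm_inv, norm_norm, inv_mul_cancel₀ hu'.ne']
  have hd1 : (1 : ℝ) ≤ d := by exact_mod_cast Nat.one_le_iff_ne_zero.2 hd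
  -- The spacing is so fine that the crude bound `∑ ‖xᵢ‖² ≤ n d²` makes the passage from `v` to the
  -- grid point cost only `n / 400`.
  obtain ⟨z, hz⟩ := exists_gridPoint_near (d := d) (N := 20 * d ^ 2) (by positivity) hv1.le
  set p := gridPoint (d := d) (20 * d ^ 2) z
  have hηd : ‖p - v‖ ^ 2 * (d : ℝ) ^ 2 ≤ 1 / 400 := by
    calc _ ≤ (d : ℝ) / ((20 * d ^ 2 : ℕ) : ℝ) ^ 2 * (d : ℝ) ^ 2 := by gcongr
      _ = 1 / (400 * d) := by push_cast; field_simp; norm_num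
      _ ≤ _ := by
        gcongr
        linarith
  have hη : ‖p - v‖ ≤ 1 / 20 := by
    have : ‖p - v‖ ^ 2 * 1 ≤ ‖p - v‖ ^ 2 * (d : ℝ) ^ 2 := by
      gcongr
      nlinarith
    exact abs_le_of_sq_le_sq' (by linarith) (by norm_num) |>.2
  have hp : 19 / 20 ≤ ‖p‖ := by
    have := norm_sub_norm_le v p
    rw [norm_sub_rev] at this
    linarith
  have hp2 : (9 : ℝ) / 10 ≤ ‖p‖ ^ 2 := by nlinarith
  have h1 : ∑ i, inner ℝ p (x i) ^ 2 ≤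
      2 * ∑ i, inner ℝ v (x i) ^ 2 + 2 * (‖p - v‖ ^ 2 * ∑ i, ‖x i‖ ^ 2) := by
    rw [Finset.mul_sum, Finset.mul_sum, Finset.mul_sum, ← Finset.sum_add_distrib]
    refine Finset.sum_le_sum fun i _ => ?_
    have h2 : inner ℝ p (x i) = inner ℝ v (x i) + inner ℝ (p - v) (x i) := by
      rw [← inner_add_left, add_sub_cancel]
    have h3 : inner ℝ (p - v) (x i) ^ 2 ≤ ‖p - v‖ ^ 2 * ‖x i‖ ^ 2 := by
      rw [← mul_pow, ← sq_abs]
      exact pow_le_pow_left₀ (abs_nonneg _) (abs_real_inner_le_norm _ _) 2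
    rw [h2]
    nlinarith [sq_nonneg (inner ℝ v (x i) - inner ℝ (p - v) (x i))]
  have h4 : ‖p - v‖ ^ 2 * ∑ i, ‖x i‖ ^ 2 ≤ n * (1 / 400) := by
    calc _ ≤ ‖p - v‖ ^ 2 * (n * (d : ℝ) ^ 2) := by gcongr
      _ = n * (‖p - v‖ ^ 2 * (d : ℝ) ^ 2) := by ring
      _ ≤ _ := by gcongr
  have h5 : (n : ℝ) * (9 / 10) ≤ n * ‖p‖ ^ 2 := by gcongr
  have hn : (0 : ℝ) ≤ n := by positivity
  -- From `9n/10 ≤ 5 (2 ∑ ⟨v, xᵢ⟩² + 2n/400)` one gets `7n/8 ≤ 10 ∑ ⟨v, xᵢ⟩²`.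
  have h6 : (n : ℝ) ≤ 16 * ∑ i, inner ℝ v (x i) ^ 2 := by linarith [hgrid z]
  have h7 : ∀ i, inner ℝ u (x i) = ‖u‖ * inner ℝ v (x i) := by
    intro i
    rw [hv, real_inner_smul_left, mul_inv_cancel_left₀ hu'.ne']
  simp only [h7, mul_pow, ← Finset.mul_sum]
  nlinarith [mul_le_mul_of_nonneg_left h6 (sq_nonneg ‖u‖)]

end Grid

/-- The probability estimate for the union bound over the grid. -/
theorem grid_union_bound {n d : ℕ} (hd : 9 ≤ d) (hn : 36 * d * Real.log d ≤ n) :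
    ((2 * (20 * d ^ 2) + 1 : ℕ) : ℝ) ^ d * (3 / 4) ^ n ≤ 1 / d ∧ (17 : ℝ) / n ≤ 1 / d ∧ n ≠ 0 := by
  have hd' : (9 : ℝ) ≤ d := by exact_mod_cast hd
  have hd0 : (0 : ℝ) < d := by linarith
  have hlog : 1 ≤ Real.log d := by
    rw [Real.le_log_iff_exp_le hd0]
    linarith [Real.exp_one_lt_d9]
  have hnd : 36 * (d : ℝ) ≤ n := by nlinarith
  have hn0 : (0 : ℝ) < n := by linarith
  refine ⟨?_, ?_, by exact_mod_cast hn0.ne'⟩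
  · have h1 : ((2 * (20 * d ^ 2) + 1 : ℕ) : ℝ) ≤ Real.exp (4 * Real.log d) := by
      have : Real.exp (4 * Real.log d) = (d : ℝ) ^ 4 := by
        rw [show (4 : ℝ) * Real.log d = ((4 : ℕ) : ℝ) * Real.log d by norm_num,
          Real.exp_nat_mul, Real.exp_log hd0]
      rw [this]
      push_cast
      nlinarith [mul_self_nonneg ((d : ℝ) ^ 2), mul_le_mul hd' hd' (by norm_num) hd0.le]
    have h2 : (3 : ℝ) / 4 ≤ Real.exp (-(1 / 4)) := by
      linarith [Real.add_one_le_exp (-(1 / 4) : ℝ)]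
    calc _ ≤ Real.exp (4 * Real.log d) ^ d * Real.exp (-(1 / 4)) ^ n := by gcongr
      _ = Real.exp (d * (4 * Real.log d) + n * (-(1 / 4))) := by
        rw [← Real.exp_nat_mul, ← Real.exp_nat_mul, ← Real.exp_add]
      _ ≤ Real.exp (-Real.log d) := Real.exp_le_exp.2 (by nlinarith)
      _ = _ := by rw [Real.exp_neg, Real.exp_log hd0, one_div]
  · rw [div_le_div_iff₀ hn0 hd0]
    linarith

/-- The event on which Gaussian inputs are well conditioned. -/
theorem exists_gaussianData_event {n k d : ℕ} (hd : 9 ≤ d) (hn : 36 * d * Real.log d ≤ n)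
    {vs : Fin k → ℝ} (hvs : ∀ l, 0 ≤ vs l) (Ws : Matrix (Fin k) (Fin d) ℝ) :
    ∃ E : Set (Fin n → EuclideanSpace ℝ (Fin d)), MeasurableSet E ∧
      1 - 3 / d ≤ (gaussianData n d).real E ∧ ∀ x ∈ E,
        (∀ u : EuclideanSpace ℝ (Fin d), n * ‖u‖ ^ 2 ≤ 16 * ∑ i, inner ℝ u (x i) ^ 2) ∧
        ∑ i, plantedLabels vs Ws x i ^ 2 ≤
          n * (14 * ∑ l, vs l * ‖WithLp.toLp 2 (Ws l)‖ ^ 2) ^ 2 := by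
  obtain ⟨hb1, hb2, hn0⟩ := grid_union_bound hd hn
  set E₁ : Set (Fin n → EuclideanSpace ℝ (Fin d)) := {x | ∑ i, ‖x i‖ ^ 2 ≤ n * (d : ℝ) ^ 2}
  set E₂ : Set (Fin n → EuclideanSpace ℝ (Fin d)) := {x | ∑ i, plantedLabels vs Ws x i ^ 2 ≤
    n * (14 * ∑ l, vs l * ‖WithLp.toLp 2 (Ws l)‖ ^ 2) ^ 2}
  set E₃ : (Fin d → Fin (2 * (20 * d ^ 2) + 1)) → Set (Fin n → EuclideanSpace ℝ (Fin d)) :=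
    fun z => {x | n * ‖gridPoint (20 * d ^ 2) z‖ ^ 2 ≤
      5 * ∑ i, inner ℝ (gridPoint (20 * d ^ 2) z) (x i) ^ 2}
  have hE₁ : MeasurableSet E₁ := measurableSet_le (by fun_prop) (by fun_prop)
  have hE₂ : MeasurableSet E₂ := by
    have hc := continuous_quadNet Ws vs
    refine measurableSet_le ?_ (by fun_prop)
    unfold plantedLabels
    fun_prop
  have hE₃ : MeasurableSet (⋂ z, E₃ z) :=
    MeasurableSet.iInter fun z => measurableSet_le (by fun_prop) (by fun_prop)
  have hE := (hE₁.inter hE₂).inter hE₃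
  refine ⟨(E₁ ∩ E₂) ∩ ⋂ z, E₃ z, hE, ?_, fun x hx => ?_⟩
  · have hcompl : (gaussianData n d).real ((E₁ ∩ E₂) ∩ ⋂ z, E₃ z)ᶜ ≤ 3 / d := by
      rw [Set.compl_inter, Set.compl_inter, Set.compl_iInter]
      have h1 := measureReal_union_le (μ := gaussianData n d) (E₁ᶜ ∪ E₂ᶜ) (⋃ z, (E₃ z)ᶜ)
      have h2 := measureReal_union_le (μ := gaussianData n d) E₁ᶜ E₂ᶜ
      have h3 : (gaussianData n d).real E₁ᶜ ≤ 1 / d :=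
        gaussianData_norm_sq_large hn0 (by omega)
      have h4 : (gaussianData n d).real E₂ᶜ ≤ 17 / n :=
        gaussianData_labels_large hn0 hvs Ws rfl
      have h5 : (gaussianData n d).real (⋃ z, (E₃ z)ᶜ) ≤ 1 / d := by
        refine (measureReal_iUnion_fintype_le _).trans ?_
        refine (Finset.sum_le_sum fun z _ =>
          gaussianData_inner_sq_small (n := n) (gridPoint (20 * d ^ 2) z)).trans ?_
        simpa using hb1
      have h6 : (3 : ℝ) / d = 1 / d + 1 / d + 1 / d := by ring
      linarith
    rw [probReal_compl_eq_one_sub hE] at hcompl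
    linarith
  · exact ⟨norm_sq_le_of_grid (by omega) hx.1.1 fun z => Set.mem_iInter.1 hx.2 z, hx.1.2⟩

theorem exists_gaussianData_event_loss_bound {n k d : ℕ} (Ws : Matrix (Fin k) (Fin d) ℝ)
    {vs : Fin k → ℝ} {ν : ℝ} (hd : 9 ≤ d) (hdk : d < k) (hν : ν ≠ 0)
    (hs : SameSign vs (fun _ => ν)) (hn : 36 * d * Real.log d ≤ n) :
    ∃ E : Set (Fin n → EuclideanSpace ℝ (Fin d)), MeasurableSet E ∧
      1 - 3 / d ≤ (gaussianData n d).real E ∧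
      ∀ x ∈ E, ∀ εg εH : ℝ, 0 ≤ εg → 0 ≤ εH →
        ∀ w, IsApproxLocalMin (plantedLoss (fun _ => ν) vs Ws x) εg εH w →
          plantedLoss (fun _ => ν) vs Ws x w ≤
            εg / √|ν| *
                max (√(1 + 14 * nuclearNorm (Wsᵀ * Matrix.diagonal vs * Ws)))
                  (4 * (εg / √|ν|)) +
              εH / (2 * |ν|) * nuclearNorm (Wsᵀ * Matrix.diagonal vs * Ws) := by
  have htr := abs_trace_le_nuclearNorm (Wsᵀ * Matrix.diagonal vs * Ws)
  set A := nuclearNorm (Wsᵀ * Matrix.diagonal vs * Ws)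
  replace htr : |∑ l, vs l * ‖WithLp.toLp 2 (Ws l)‖ ^ 2| ≤ A := by
    rwa [trace_transpose_mul_diagonal_mul] at htr
  -- The sign change below alters the matrix inside `A`; only the bound on the absolute trace, which
  -- is invariant, is kept.
  clear_value A
  wlog hpos : (∀ l, 0 ≤ vs l) ∧ ∀ _ : Fin k, 0 ≤ ν generalizing vs ν
  · have hneg := hs.resolve_left hpos
    have h := this (vs := -vs) (ν := -ν) (neg_ne_zero.2 hν) (Or.inl ?_) ?_ ?_
    · have e : (fun _ : Fin k => -ν) = -fun _ => ν := rfl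
      simpa only [e, plantedLoss_neg, abs_neg] using h
    · exact ⟨fun l => neg_nonneg.2 (hneg.1 l), fun l => neg_nonneg.2 (hneg.2 l)⟩
    · simpa [Finset.sum_neg_distrib] using htr
    · exact ⟨fun l => neg_nonneg.2 (hneg.1 l), fun l => neg_nonneg.2 (hneg.2 l)⟩
  have hν' : 0 < ν := lt_of_le_of_ne (hpos.2 ⟨0, by omega⟩) hν.symm
  obtain ⟨E, hE, hP, hEx⟩ := exists_gaussianData_event hd hn hpos.1 Ws
  refine ⟨E, hE, hP, fun x hx εg εH hg hH w hw => ?_⟩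
  rw [abs_of_pos hν']
  refine (plantedLoss_le_of_isApproxLocalMin (grid_union_bound hd hn).2.2 hdk hν' hpos.1 Ws rfl
    (hEx x hx).1 (hEx x hx).2 hg hH hw).trans ?_
  have := (le_abs_self _).trans htr
  gcongr

theorem theorem2 :
    (∃ c : ℝ, 0 < c ∧
      ∀ (n k d : ℕ) (Ws : Matrix (Fin k) (Fin d) ℝ) (vs v : Fin k → ℝ),
        0 < sigmaMin Ws → d ≤ k → SameSign vs v → d ≤ Nat.card {l // v l ≠ 0} →
        d ≤ n → (n : ℝ) ≤ c * (d : ℝ) ^ 2 →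
        ∀ᵐ x : Fin n → EuclideanSpace ℝ (Fin d) ∂volume,
          -- local minima are global
          (∀ w, IsLocalMin (plantedLoss v vs Ws x) w →
            IsMinOn (plantedLoss v vs Ws x) Set.univ w) ∧
          -- critical points other than local minima (so all saddles) have negative curvature
          (∀ w, gradient (plantedLoss v vs Ws x) w = 0 →
            ¬ IsLocalMin (plantedLoss v vs Ws x) w →
            ∃ u, hessForm (plantedLoss v vs Ws x) w u < 0) ∧
          -- global optima exist and have loss zero
          (∃ w, IsMinOn (plantedLoss v vs Ws x) Set.univ w) ∧
          (∀ w, IsMinOn (plantedLoss v vs Ws x) Set.univ w → plantedLoss v vs Ws x w = 0)) ∧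
    (∃ c C γ : ℝ, 0 < c ∧ 0 < C ∧ 0 < γ ∧
      ∀ (n k d : ℕ) (Ws : Matrix (Fin k) (Fin d) ℝ) (vs : Fin k → ℝ) (ν : ℝ),
        0 < sigmaMin Ws → d < k → ν ≠ 0 → SameSign vs (fun _ => ν) →
        c * d * Real.log d ≤ n → (n : ℝ) ≤ C * (d : ℝ) ^ 2 →
        ∃ E : Set (Fin n → EuclideanSpace ℝ (Fin d)), MeasurableSet E ∧
          1 - 12 * d * Real.exp (-γ * d) - 8 / d ≤ (gaussianData n d).real E ∧
          ∀ x ∈ E, ∀ εg εH : ℝ, 0 ≤ εg → 0 ≤ εH →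
            ∀ w, IsApproxLocalMin (plantedLoss (fun _ => ν) vs Ws x) εg εH w →
              plantedLoss (fun _ => ν) vs Ws x w ≤
                εg / √|ν| *
                    max (√(1 + 14 * nuclearNorm (Wsᵀ * Matrix.diagonal vs * Ws)))
                      (4 * (εg / √|ν|)) +
                  εH / (2 * |ν|) * nuclearNorm (Wsᵀ * Matrix.diagonal vs * Ws)) := by
  refine ⟨⟨1 / 4, by norm_num, fun n k d Ws vs v hW _ hs hcard hdn hn =>
    plantedLoss_generic_landscape Ws vs v hW hs hcard hdn hn⟩,
    36, 1, 1, by norm_num, by norm_num, by norm_num, fun n k d Ws vs ν hW hdk hν hs hn _ => ?_⟩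
  have hexp : 0 ≤ 12 * (d : ℝ) * Real.exp (-1 * d) := by positivity
  -- For `1 ≤ d ≤ 8` the term `8 / d` is at least `1`, so the empty event suffices. The case `d =
  -- 0`, where `8 / d` would be `0`, is excluded by `hW`.
  rcases Nat.lt_or_ge d 9 with hd | hd
  · refine ⟨∅, MeasurableSet.empty, ?_, fun x hx => absurd hx (Set.notMem_empty x)⟩
    have hd0 : 0 < d := by
      rcases Nat.eq_zero_or_pos d with rfl | h
      · simp [sigmaMin, LinearMap.singularValues_of_finrank_le] at hW
      · exact h
    have h8 : (1 : ℝ) ≤ 8 / d := by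
      rw [one_le_div (by positivity)]
      exact_mod_cast Nat.lt_succ_iff.1 hd
    rw [measureReal_empty]
    linarith
  · obtain ⟨E, hE, hP, hEx⟩ := exists_gaussianData_event_loss_bound Ws hd hdk hν hs hn
    refine ⟨E, hE, le_trans ?_ hP, hEx⟩
    have h3 : (3 : ℝ) / d ≤ 8 / d := by gcongr; norm_num
    linarith
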